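/- Let $q$ be a prime power, let $\mathbb{F}_{q^m}/\mathbb{F}_q$ be an extension of degree $m$ of finite fields with trace $\mathrm{Tr}$, let $s\ge 1$ and $1\le \ell_1<\ell_2<\cdots<\ell_s<\frac m2$ be integers, and let $\mathcal{L}=\langle x^{q^{\ell_1}},\ldots,x^{q^{\ell_s}}\rangle$ be the $\mathbb{F}_{q^m}$-subspace of $\mathbb{F}_{q^m}[x]$ spanned by these monomials. For $R\in\mathcal{L}$ let $Q_R(x)=\mathrm{Tr}(xR(x))$, a quadratic form on the $\mathbb{F}_q$-space $\mathbb{F}_{q^m}$. The rank of a quadratic form is the least number of variables (linear forms) in which it can be written. A quadratic form of even rank $r$ is of type $1$ if in suitable linear coordinates it is $x_1x_2+\cdots+x_{r-1}x_r$, and of type $3$ if $r\ge 2$ and in suitable linear coordinates it is $x_1x_2+\cdots+x_{r-3}x_{r-2}+(x_{r-1}^2+a\,x_{r-1}x_r+b\,x_r^2)$ with $a,b\in\mathbb{F}_q$ such that the binary form in brackets has only the trivial zero over $\mathbb{F}_q$. Put $$M_r=\#\{R\in\mathcal{L}: Q_R \text{ has rank } r\},\qquad R_{\mathcal{L}}=\{r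 : M_r>0\},$$ and let $M_{r,1}$ (resp. $M_{r,2}$) be the number of $R\in\mathcal{L}\smallsetminus\{0\}$ such that $Q_R$ has rank $r$ and is of type $1$ (resp. of type $3$). Consider the codes of length $q^m-1$ over $\mathbb{F}_q$ $$\mathcal{C}_{\mathcal{L},1}=\big\{\big(\mathrm{Tr}(xR(x)+\beta x)\big)_{x\in\mathbb{F}_{q^m}^*}: R\in\mathcal{L},\ \beta\in\mathbb{F}_{q^m}\big\},$$ $$\mathcal{C}_{\mathcal{L},2}=\big\{\big(\mathrm{Tr}(xR(x)+\beta x)+b\big)_{x\in\mathbb{F}_{q^m}^*}: R\in\mathcal{L},\ \beta\in\mathbb{F}_{q^m},\ b\in\mathbb{F}_q\big\}.$$ Suppose that $\mathcal{L}$ is an even rank family, i.e. $Q_R$ has even rank for every $R\in\mathcal{L}$. Then $\mathcal{C}_{\mathcal{L},1}$ and $\mathcal{C}_{\mathcal{L},2}$ are cyclic codes (the coordinates being ordered as $x=1,\alpha,\alpha^2,\ldots,\alpha^{q^m-2}$ for a generator $\alpha$ of $\mathbb{F}_{q^m}^*$), their dimensions over $\mathbb{F}_q$ are $m(s+1)$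 and $m(s+1)+1$ respectively, and their weight distributions are given by the following tables, where $r$ runs over $R_{\mathcal{L}}$ and $i$ over $\{1,2\}$, and where the number of words of weight $w$ is the sum of the frequencies of all the rows whose weight equals $w$ (rows with frequency $0$ contribute nothing; in particular $M_{0,i}=0$). Weight distribution of $\mathcal{C}_{\mathcal{L},1}$: $$\begin{array}{l|l} \text{weight} & \text{frequency}\\ \hline 0 & 1\\ q^m-q^{m-1} & \sum_{r\in R_{\mathcal{L}}}M_r(q^m-q^r)\\ q^m-q^{m-1}+(-1)^i(q-1)q^{m-\frac r2-1} & M_{r,i}\big(q^{r-1}+(-1)^{i+1}(q-1)q^{\frac r2-1}\big)\\ q^m-q^{m-1}+(-1)^{i+1}q^{m-\frac r2-1} & M_{r,i}\big(q^{r-1}+(-1)^{i}q^{\frac r2-1}\big)(q-1) \end{array}$$ Weight distribution of $\mathcal{C}_{\mathcal{L},2}$: all the rows of the previous table, and in addition $$\begin{array}{l|l} \text{weight} & \text{frequency}\\ \hline q^m-1 & q-1\\ q^m-q^{m-1}-1 & (q-1)\sum_{r\in R_{\mathcal{L}}}M_r(q^m-q^r)\\ q^m-q^{m-1}-1+(-1)^i(q-1)q^{m-\frac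 r2-1} & M_{r,i}\big(q^{r-1}+(-1)^{i}q^{\frac r2-1}\big)(q-1)\\ q^m-q^{m-1}-1+(-1)^{i+1}q^{m-\frac r2-1} & M_{r,i}\big(q^{r}-q^{r-1}+(-1)^{i+1}q^{\frac r2-1}\big)(q-1) \end{array}$$ -/

import Mathlib

open Polynomial

noncomputable section

/-- The rank of a quadratic form `Q : F → K` on a finite dimensional `K`-space `F`: the least number
of variables (linear forms on `F`) needed to write `Q` as a quadratic form in these variables. -/
def qfRank (K : Type*) {F : Type*} [Field K] [Field F] [Algebra K F] (Q : F → K) : ℕ :=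
  sInf {r : ℕ | ∃ (f : F →ₗ[K] (Fin r → K)) (P : QuadraticForm K (Fin r → K)), ∀ x, Q x = P (f x)}

/-- Type `1`: in suitable linear coordinates `Q` is the hyperbolic form `∑ u_j v_j`
(the coordinates `u_j`, `v_j` being part of a basis of the dual space). -/
def IsTypeOne (K : Type*) {F : Type*} [Field K] [Field F] [Algebra K F] (Q : F → K) : Prop :=
  ∃ (k : ℕ) (u v : Fin k → Module.Dual K F), LinearIndependent K (Sum.elim u v) ∧
    ∀ x, Q x = ∑ j, u j x * v j x

/-- Type `3`: in suitable linear coordinates `Q` is `∑ u_j v_j + (y² + a y z + b z²)`, where the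
binary form `y² + a y z + b z²` is anisotropic. -/
def IsTypeThree (K : Type*) {F : Type*} [Field K] [Field F] [Algebra K F] (Q : F → K) : Prop :=
  ∃ (k : ℕ) (u v : Fin k → Module.Dual K F) (e : Fin 2 → Module.Dual K F) (a b : K),
    LinearIndependent K (Sum.elim (Sum.elim u v) e) ∧
    (∀ y z : K, y ^ 2 + a * y * z + b * z ^ 2 = 0 → y = 0 ∧ z = 0) ∧
    ∀ x, Q x = ∑ j, u j x * v j x + (e 0 x ^ 2 + a * e 0 x * e 1 x + b * e 1 x ^ 2)

/-- The index `i = 1` stands for type `1`, the index `i = 2` for type `3`. -/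
def HasTypeIndex (K : Type*) {F : Type*} [Field K] [Field F] [Algebra K F] (Q : F → K) :
    ℕ → Prop
  | 1 => IsTypeOne K Q
  | 2 => IsTypeThree K Q
  | _ => False

/-- `Q_R(x) = Tr(x R(x))`. -/
def traceForm (K : Type*) {F : Type*} [Field K] [Field F] [Algebra K F] (R : F[X]) (x : F) : K :=
  Algebra.trace K F (x * R.eval x)

/-- The `F`-span of `x^(q^ℓ₁), …, x^(q^ℓₛ)` in `F[x]`, with `q = |K|`. -/
def linearizedSpan (K F : Type*) [Field K] [Fintype K] [Field F] {s : ℕ} (ℓ : Fin s → ℕ) :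
    Submodule F F[X] :=
  Submodule.span F (Set.range fun i => (X : F[X]) ^ (Fintype.card K ^ ℓ i))

/-- All the forms `Q_R`, `R ∈ L`, have even rank. -/
def IsEvenRankFamily (K : Type*) {F : Type*} [Field K] [Field F] [Algebra K F]
    (L : Submodule F F[X]) : Prop :=
  ∀ R ∈ L, Even (qfRank K (traceForm K R))

/-- The set of ranks `R_L`. -/
def rankSet (K : Type*) {F : Type*} [Field K] [Field F] [Algebra K F]
    (L : Submodule F F[X]) : Set ℕ :=
  {r | ∃ R ∈ L, qfRank K (traceForm K R) = r}

/-- `M_r`. -/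
def rankCount (K : Type*) {F : Type*} [Field K] [Field F] [Algebra K F]
    (L : Submodule F F[X]) (r : ℕ) : ℕ :=
  Set.ncard {R : F[X] | R ∈ L ∧ qfRank K (traceForm K R) = r}

/-- `M_{r,i}`. -/
def rankTypeCount (K : Type*) {F : Type*} [Field K] [Field F] [Algebra K F]
    (L : Submodule F F[X]) (r i : ℕ) : ℕ :=
  Set.ncard {R : F[X] | R ∈ L ∧ R ≠ 0 ∧ qfRank K (traceForm K R) = r ∧
    HasTypeIndex K (traceForm K R) i}

/-- The word `c_{R,b}(β) = (Tr(x R(x) + β x) + b)`, with coordinates indexed by `x ∈ F^*`. -/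
def codeword (K : Type*) {F : Type*} [Field K] [Field F] [Algebra K F]
    (R : F[X]) (β : F) (b : K) : Fˣ → K :=
  fun x => Algebra.trace K F ((x : F) * R.eval (x : F) + β * (x : F)) + b

theorem codeword_add (K : Type*) {F : Type*} [Field K] [Field F] [Algebra K F]
    (R R' : F[X]) (β β' : F) (b b' : K) :
    codeword K (R + R') (β + β') (b + b') = codeword K R β b + codeword K R' β' b' := by
  funext x
  simp only [codeword, Pi.add_apply, eval_add, mul_add, add_mul, map_add]
  ring

theorem codeword_zero (K : Type*) {F : Type*} [Field K] [Field F] [Algebra K F] :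
    codeword K (0 : F[X]) 0 0 = 0 := by
  funext x
  simp [codeword]

theorem codeword_smul (K : Type*) {F : Type*} [Field K] [Field F] [Algebra K F]
    (a : K) (R : F[X]) (β : F) (b : K) :
    codeword K (algebraMap K F a • R) (algebraMap K F a * β) (a * b) = a • codeword K R β b := by
  funext x
  have h : (x : F) * (algebraMap K F a • R).eval (x : F) + algebraMap K F a * β * (x : F)
      = a • ((x : F) * R.eval (x : F) + β * (x : F)) := by
    rw [eval_smul, smul_eq_mul, Algebra.smul_def]
    ring
  simp only [codeword, Pi.smul_apply, h, map_smul, smul_eq_mul]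
  ring

/-- The code `C_{L,1}`, of length `|F^*|`. -/
def codeOne (K : Type*) {F : Type*} [Field K] [Field F] [Algebra K F]
    (L : Submodule F F[X]) : Submodule K (Fˣ → K) where
  carrier := {c | ∃ R ∈ L, ∃ β : F, c = codeword K R β 0}
  add_mem' := by
    rintro _ _ ⟨R, hR, β, rfl⟩ ⟨R', hR', β', rfl⟩
    exact ⟨R + R', L.add_mem hR hR', β + β', by rw [← codeword_add, add_zero]⟩
  zero_mem' := ⟨0, L.zero_mem, 0, (codeword_zero K).symm⟩
  smul_mem' := by
    rintro a _ ⟨R, hR, β, rfl⟩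
    exact ⟨_, L.smul_mem (algebraMap K F a) hR, algebraMap K F a * β, by
      rw [← codeword_smul, mul_zero]⟩

/-- The code `C_{L,2}`, of length `|F^*|`. -/
def codeTwo (K : Type*) {F : Type*} [Field K] [Field F] [Algebra K F]
    (L : Submodule F F[X]) : Submodule K (Fˣ → K) where
  carrier := {c | ∃ R ∈ L, ∃ (β : F) (b : K), c = codeword K R β b}
  add_mem' := by
    rintro _ _ ⟨R, hR, β, b, rfl⟩ ⟨R', hR', β', b', rfl⟩
    exact ⟨R + R', L.add_mem hR hR', β + β', b + b', by rw [← codeword_add]⟩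
  zero_mem' := ⟨0, L.zero_mem, 0, 0, (codeword_zero K).symm⟩
  smul_mem' := by
    rintro a _ ⟨R, hR, β, b, rfl⟩
    exact ⟨_, L.smul_mem (algebraMap K F a) hR, algebraMap K F a * β, a * b, by
      rw [← codeword_smul]⟩

/-- Cyclicity of a code whose coordinates are ordered as `1, α, α², …`, for every generator `α` of
`F^*`: the cyclic shift of a word is again a word. -/
def IsCyclicCode {K F : Type*} [Field K] [Field F] (C : Submodule K (Fˣ → K)) : Prop :=
  ∀ α : Fˣ, (∀ x : Fˣ, x ∈ Subgroup.zpowers α) → ∀ c ∈ C, (fun x : Fˣ => c (α⁻¹ * x)) ∈ C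

/-- The frequency `A_w`: the number of words of Hamming weight `w`. -/
def weightFreq {K ι : Type*} [Field K] [DecidableEq K] [Fintype ι]
    (C : Submodule K (ι → K)) (w : ℕ) : ℕ :=
  Set.ncard {c : ι → K | c ∈ C ∧ hammingNorm c = w}

/-- The contribution to `A_w` of the row of a table with the given weight and frequency. The
frequency `A_w` described by a table is the sum of the contributions of its rows, so that the
frequencies of rows with the same weight are added. -/
def tableRow (weight freq : ℚ) (w : ℕ) : ℚ :=
  if (w : ℚ) = weight then freq else 0

/-- The weight distribution of `C_{L,1}`; `q` is the size of the field of constants, `Rset` the set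
of ranks, `M r = M_r` and `Mi r i = M_{r,i}`. -/
def tableOne (q m : ℕ) (Rset : Set ℕ) (M : ℕ → ℕ) (Mi : ℕ → ℕ → ℕ) (w : ℕ) : ℚ :=
  tableRow 0 1 w
  + tableRow ((q : ℚ) ^ m - (q : ℚ) ^ ((m : ℤ) - 1))
      (∑ᶠ r ∈ Rset, (M r : ℚ) * ((q : ℚ) ^ m - (q : ℚ) ^ r)) w
  + ∑ᶠ r ∈ Rset, ∑ i ∈ ({1, 2} : Finset ℕ),
    (tableRow
        ((q : ℚ) ^ m - (q : ℚ) ^ ((m : ℤ) - 1)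
          + (-1) ^ i * ((q : ℚ) - 1) * (q : ℚ) ^ ((m : ℤ) - (r : ℤ) / 2 - 1))
        ((Mi r i : ℚ) * ((q : ℚ) ^ ((r : ℤ) - 1)
          + (-1) ^ (i + 1) * ((q : ℚ) - 1) * (q : ℚ) ^ ((r : ℤ) / 2 - 1))) w
      + tableRow
        ((q : ℚ) ^ m - (q : ℚ) ^ ((m : ℤ) - 1)
          + (-1) ^ (i + 1) * (q : ℚ) ^ ((m : ℤ) - (r : ℤ) / 2 - 1))
        ((Mi r i : ℚ) * ((q : ℚ) ^ ((r : ℤ) - 1)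
          + (-1) ^ i * (q : ℚ) ^ ((r : ℤ) / 2 - 1)) * ((q : ℚ) - 1)) w)

/-- The weight distribution of `C_{L,2}`: the rows for `C_{L,1}` and those of the words with
`b ≠ 0`. -/
def tableTwo (q m : ℕ) (Rset : Set ℕ) (M : ℕ → ℕ) (Mi : ℕ → ℕ → ℕ) (w : ℕ) : ℚ :=
  tableOne q m Rset M Mi w
  + tableRow ((q : ℚ) ^ m - 1) ((q : ℚ) - 1) w
  + tableRow ((q : ℚ) ^ m - (q : ℚ) ^ ((m : ℤ) - 1) - 1)
      (((q : ℚ) - 1) * ∑ᶠ r ∈ Rset, (M r : ℚ) * ((q : ℚ) ^ m - (q : ℚ) ^ r)) w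
  + ∑ᶠ r ∈ Rset, ∑ i ∈ ({1, 2} : Finset ℕ),
    (tableRow
        ((q : ℚ) ^ m - (q : ℚ) ^ ((m : ℤ) - 1) - 1
          + (-1) ^ i * ((q : ℚ) - 1) * (q : ℚ) ^ ((m : ℤ) - (r : ℤ) / 2 - 1))
        ((Mi r i : ℚ) * ((q : ℚ) ^ ((r : ℤ) - 1)
          + (-1) ^ i * (q : ℚ) ^ ((r : ℤ) / 2 - 1)) * ((q : ℚ) - 1)) w
      + tableRow
        ((q : ℚ) ^ m - (q : ℚ) ^ ((m : ℤ) - 1) - 1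
          + (-1) ^ (i + 1) * (q : ℚ) ^ ((m : ℤ) - (r : ℤ) / 2 - 1))
        ((Mi r i : ℚ) * ((q : ℚ) ^ r - (q : ℚ) ^ ((r : ℤ) - 1)
          + (-1) ^ (i + 1) * (q : ℚ) ^ ((r : ℤ) / 2 - 1)) * ((q : ℚ) - 1)) w)

end

/-! Fix `R`. The form `Q_R` factors through a surjection `f` onto a space carrying a form `P` whose
polar form is nondegenerate, of dimension `r = 2h`. If the functional `Tr(β ·)` is nonzero on `ker
f`, then `Q_R + Tr(β ·) + b` takes every value equally often; this happens for `q^m - q^r` values of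
`β`. Otherwise `Tr(β ·) = polar P c ∘ f` for a unique `c`, and completing the square gives `|ker f|
* #{y | P y = P c - b}` zeros. This count depends only on whether `P c = b`, and the number of such
`c` is again a fibre size of `P`. So the fibre sizes of `P` yield both weights and frequencies
(`sum_card_zeros_add_trace`, `HasTypeIndex.sum_card_zeros`).

The fibre sizes are computed from a Witt decomposition into hyperbolic planes and an anisotropic
form. By Chevalley–Warning the anisotropic part has dimension at most two, so even rank leaves
dimension zero (type 1) or two (type 3, where the form is a multiplicative norm form and each
nonzero value is taken `q + 1` times). The two types differ by the sign of one term in the fibre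
sizes, hence exclude each other.

To pass from parameters to words, `(R, β, b)` must be determined by its word. The polar form of
`Q_R` is given by `R` plus its adjoint for the trace form, and the conditions `1 ≤ ℓ i < m/2` keep
the exponents of the two apart, so `R` can be recovered (`eq_zero_of_polar_traceForm_eq_zero`).
Summing over `R` by rank and type (`sum_by_type`, `sum_by_rank`) gives the tables; `R = 0` supplies
the isolated rows of weight `0` and `q^m - 1`. -/

/-! ### Independence of linear forms as surjectivity of the map they define -/

open Module in
theorem linearIndependent_dual_iff_pi_surjective {K V ι : Type*} [Field K] [AddCommGroup V]
    [Module K V] [Fintype ι] (φ : ι → Dual K V) :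
    LinearIndependent K φ ↔ Function.Surjective (LinearMap.pi φ) := by
  classical
  rw [Fintype.linearIndependent_iff]
  constructor
  · intro h
    -- A functional on `ι → K` killed by the dual map is a linear relation among the `φ i`.
    rw [← LinearMap.dualMap_injective_iff, injective_iff_map_eq_zero]
    intro g hg
    have hg' := h (fun i => g (Pi.single i 1)) (by
      ext x
      have := LinearMap.congr_fun hg x
      rw [LinearMap.dualMap_apply, LinearMap.pi_apply_eq_sum_univ g] at this
      have hs : ∀ i : ι, (Pi.single i 1 : ι → K) = fun j => if i = j then 1 else 0 := by
        intro i
        ext j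
        simp [Pi.single_apply, eq_comm]
      simpa [mul_comm, hs] using this)
    ext i
    simpa using hg' i
  · intro h g hg i
    obtain ⟨x, hx⟩ := h (Pi.single i 1)
    have h1 := LinearMap.congr_fun hg x
    have h2 : ∀ j, φ j x = (Pi.single i 1 : ι → K) j := fun j => congrFun hx j
    simpa [h2, Pi.single_apply] using h1

open Module in
theorem linearIndependent_sumElim_dual_iff_surjective {K V ι κ : Type*} [Field K] [AddCommGroup V]
    [Module K V] [Fintype ι] [Fintype κ] (u : ι → Dual K V) (v : κ → Dual K V) :
    LinearIndependent K (Sum.elim u v) ↔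
      Function.Surjective ((LinearMap.pi u).prod (LinearMap.pi v)) := by
  rw [linearIndependent_dual_iff_pi_surjective]
  constructor
  · rintro h ⟨a, b⟩
    obtain ⟨x, hx⟩ := h (Sum.elim a b)
    refine ⟨x, Prod.ext (funext fun i => ?_) (funext fun i => ?_)⟩
    · exact congrFun hx (Sum.inl i)
    · exact congrFun hx (Sum.inr i)
  · intro h c
    obtain ⟨x, hx⟩ := h (c ∘ Sum.inl, c ∘ Sum.inr)
    refine ⟨x, funext fun i => ?_⟩
    rcases i with i | i
    · exact congrFun (congrArg Prod.fst hx) i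
    · exact congrFun (congrArg Prod.snd hx) i

open Module in
theorem linearIndependent_sumElim_sumElim_dual_iff_surjective {K V ι κ τ : Type*} [Field K]
    [AddCommGroup V] [Module K V] [Fintype ι] [Fintype κ] [Fintype τ]
    (u : ι → Dual K V) (v : κ → Dual K V) (e : τ → Dual K V) :
    LinearIndependent K (Sum.elim (Sum.elim u v) e) ↔
      Function.Surjective (((LinearMap.pi u).prod (LinearMap.pi v)).prod (LinearMap.pi e)) := by
  rw [linearIndependent_sumElim_dual_iff_surjective]
  constructor
  · rintro h ⟨⟨a, b⟩, c⟩
    obtain ⟨x, hx⟩ := h (Sum.elim a b, c)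
    refine ⟨x, Prod.ext (Prod.ext (funext fun i => ?_) (funext fun i => ?_)) ?_⟩
    · exact congrFun (congrArg Prod.fst hx) (Sum.inl i)
    · exact congrFun (congrArg Prod.fst hx) (Sum.inr i)
    · have h2 := congrArg Prod.snd hx
      exact h2
  · rintro h ⟨c, d⟩
    obtain ⟨x, hx⟩ := h ((c ∘ Sum.inl, c ∘ Sum.inr), d)
    have h2 := congrArg Prod.snd hx
    refine ⟨x, Prod.ext (funext fun i => ?_) h2⟩
    rcases i with i | i
    · exact congrFun (congrArg (fun z => z.1.1) hx) i
    · exact congrFun (congrArg (fun z => z.1.2) hx) i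

/-! ### Witt decomposition and rank -/

/-- The coordinate space of a sum of `k` hyperbolic planes and a space of dimension `t`. -/
abbrev WittSpace (K : Type*) (k t : ℕ) : Type _ := ((Fin k → K) × (Fin k → K)) × (Fin t → K)

/-- The orthogonal sum of `k` hyperbolic planes and the form `N`. -/
def wittForm {K : Type*} [Field K] (k : ℕ) {t : ℕ} (N : QuadraticForm K (Fin t → K)) :
    QuadraticForm K (WittSpace K k t) :=
  ∑ j, QuadraticMap.linMulLin
      (LinearMap.proj j ∘ₗ LinearMap.fst K _ _ ∘ₗ LinearMap.fst K _ _)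
      (LinearMap.proj j ∘ₗ LinearMap.snd K _ _ ∘ₗ LinearMap.fst K _ _)
    + N.comp (LinearMap.snd K _ _)

theorem wittForm_apply {K : Type*} [Field K] {k t : ℕ} (N : QuadraticForm K (Fin t → K))
    (y : WittSpace K k t) : wittForm k N y = ∑ j, y.1.1 j * y.1.2 j + N y.2 := by
  simp [wittForm]

theorem polar_wittForm {K : Type*} [Field K] {k t : ℕ} (N : QuadraticForm K (Fin t → K))
    (x y : WittSpace K k t) : QuadraticMap.polar (wittForm k N) x y =
      ∑ j, (x.1.1 j * y.1.2 j + y.1.1 j * x.1.2 j) + QuadraticMap.polar N x.2 y.2 := by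
  simp only [QuadraticMap.polar, wittForm_apply, Prod.fst_add, Prod.snd_add, Pi.add_apply]
  have : ∑ j, (x.1.1 j + y.1.1 j) * (x.1.2 j + y.1.2 j) = ∑ j, x.1.1 j * x.1.2 j +
      ∑ j, y.1.1 j * y.1.2 j + ∑ j, (x.1.1 j * y.1.2 j + y.1.1 j * x.1.2 j) := by
    rw [← Finset.sum_add_distrib, ← Finset.sum_add_distrib]
    exact Finset.sum_congr rfl fun j _ => by ring
  rw [this]
  ring

theorem fst_eq_zero_of_polar_wittForm {K : Type*} [Field K] {k t : ℕ}
    {N : QuadraticForm K (Fin t → K)} {x : WittSpace K k t}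
    (h : ∀ y, QuadraticMap.polar (wittForm k N) x y = 0) : x.1 = 0 := by
  refine Prod.ext (funext fun i => ?_) (funext fun i => ?_)
  · simpa [polar_wittForm, Pi.single_apply] using h ((0, Pi.single i 1), 0)
  · simpa [polar_wittForm, Pi.single_apply] using h ((Pi.single i 1, 0), 0)

theorem snd_polar_eq_zero_of_polar_wittForm {K : Type*} [Field K] {k t : ℕ}
    {N : QuadraticForm K (Fin t → K)} {x : WittSpace K k t}
    (h : ∀ y, QuadraticMap.polar (wittForm k N) x y = 0) (z : Fin t → K) :
    QuadraticMap.polar N x.2 z = 0 := by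
  simpa [polar_wittForm] using h ((0, 0), z)

/-- The polar condition removes the hyperbolic part, and then the value itself must be used: in
characteristic 2 the polar form of an anisotropic `N` can vanish, as for a square in one variable.
-/
theorem wittForm_radical_of_anisotropic {K : Type*} [Field K] {k t : ℕ}
    {N : QuadraticForm K (Fin t → K)} (hN : N.Anisotropic) {x : WittSpace K k t}
    (h0 : wittForm k N x = 0) (h : ∀ y, QuadraticMap.polar (wittForm k N) x y = 0) : x = 0 := by
  have h1 := fst_eq_zero_of_polar_wittForm h
  refine Prod.ext h1 (hN _ ?_)
  simpa [wittForm_apply, h1] using h0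

theorem finrank_wittSpace (K : Type*) [Field K] (k t : ℕ) :
    Module.finrank K (WittSpace K k t) = 2 * k + t := by
  simp; ring

/-- A form that factors through a surjection onto a space carrying a form with trivial radical has
the dimension of this space as its rank. -/
theorem qfRank_eq_finrank {K F X : Type*} [Field K] [Field F] [Algebra K F] [FiniteDimensional K F]
    [AddCommGroup X] [Module K X] [FiniteDimensional K X] {Q : F → K} (f : F →ₗ[K] X)
    (hf : Function.Surjective f) (P : QuadraticForm K X)
    (hP : ∀ x, P x = 0 → (∀ y, QuadraticMap.polar P x y = 0) → x = 0)
    (hQ : ∀ x, Q x = P (f x)) : qfRank K Q = Module.finrank K X := by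
  apply le_antisymm
  · let e : X ≃ₗ[K] (Fin (Module.finrank K X) → K) := (Module.finBasis K X).equivFun
    exact Nat.sInf_le ⟨e.toLinearMap ∘ₗ f, P.comp e.symm.toLinearMap, fun x => by simp [hQ]⟩
  · apply le_csInf
    · let e : X ≃ₗ[K] (Fin (Module.finrank K X) → K) := (Module.finBasis K X).equivFun
      exact ⟨_, e.toLinearMap ∘ₗ f, P.comp e.symm.toLinearMap, fun x => by simp [hQ]⟩
    · rintro r ⟨g, P', hg⟩
      -- A vector that another factorization kills lies in the radical of `Q`, and `hP` says that
      -- this radical is `ker f`.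
      have hker : LinearMap.ker g ≤ LinearMap.ker f := by
        intro x hx
        rw [LinearMap.mem_ker] at hx ⊢
        refine hP _ ?_ fun y => ?_
        · rw [← hQ, hg, hx, QuadraticMap.map_zero]
        · obtain ⟨y, rfl⟩ := hf y
          rw [QuadraticMap.polar, ← map_add, ← hQ, ← hQ, ← hQ, hg, hg, hg, map_add, hx]
          simp
      have h1 := Submodule.finrank_mono hker
      have h2 := LinearMap.finrank_range_add_finrank_ker f
      have h3 := LinearMap.finrank_range_add_finrank_ker g
      have h4 : Module.finrank K (LinearMap.range g) ≤ r := by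
        simpa using Submodule.finrank_le (LinearMap.range g)
      rw [LinearMap.range_eq_top.2 hf, finrank_top] at h2
      omega

/-- A quadratic form with an isotropic vector outside its radical splits off a hyperbolic plane. -/
theorem exists_hyperbolic_pair {K V : Type*} [Field K] [AddCommGroup V] [Module K V]
    (Q : QuadraticForm K V) {x y : V} (hx : Q x = 0) (hxy : QuadraticMap.polar Q x y ≠ 0) :
    ∃ y', Q y' = 0 ∧ QuadraticMap.polar Q x y' = 1 := by
  set c := (QuadraticMap.polar Q x y)⁻¹ with hc
  -- The factor `c` normalizes the pairing with `x`; the multiple of `x` cancels `Q (c • y)` and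
  -- leaves the pairing alone, since `polar Q x x = 2 Q x = 0`.
  refine ⟨c • y - (c * c * Q y) • x, ?_, ?_⟩
  · have h := QuadraticMap.map_add Q (c • y) (-((c * c * Q y) • x))
    rw [← sub_eq_add_neg] at h
    rw [h, QuadraticMap.map_neg, QuadraticMap.map_smul, QuadraticMap.map_smul,
      QuadraticMap.polar_neg_right, QuadraticMap.polar_smul_right, QuadraticMap.polar_smul_left,
      QuadraticMap.polar_comm Q y x, hx]
    simp only [smul_eq_mul]
    have : c * QuadraticMap.polar Q x y = 1 := by rw [hc]; exact inv_mul_cancel₀ hxy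
    linear_combination (-(c * c * Q y)) * this
  · rw [QuadraticMap.polar_sub_right, QuadraticMap.polar_smul_right, QuadraticMap.polar_smul_right,
      QuadraticMap.polar_self, hx]
    simp [hc, hxy]

/-- **Witt decomposition**: a quadratic form is, in suitable linear coordinates, the sum of
hyperbolic planes and an anisotropic form. -/
theorem exists_witt_decomposition {K : Type*} [Field K] (n : ℕ) : ∀ {V : Type*} [AddCommGroup V]
    [Module K V] [FiniteDimensional K V] (Q : QuadraticForm K V), Module.finrank K V = n →
    ∃ (k t : ℕ) (N : QuadraticForm K (Fin t → K)) (f : V →ₗ[K] WittSpace K k t),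
      N.Anisotropic ∧ Function.Surjective f ∧ ∀ x, Q x = wittForm k N (f x) := by
  induction n using Nat.strong_induction_on with
  | _ n ih =>
  intro V _ _ _ Q hn
  by_cases hQ : Q.Anisotropic
  · let e : V ≃ₗ[K] (Fin n → K) := (Module.finBasisOfFinrankEq K V hn).equivFun
    refine ⟨0, n, Q.comp e.symm.toLinearMap, LinearMap.inr K _ _ ∘ₗ e.toLinearMap, ?_, ?_, ?_⟩
    · intro x hx
      simpa using hQ _ hx
    · rintro ⟨a, b⟩
      exact ⟨e.symm b, Prod.ext (Subsingleton.elim _ _) (by simp)⟩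
    · intro x
      simp [wittForm_apply]
  obtain ⟨x, hx0, hx⟩ := (QuadraticMap.not_anisotropic_iff_exists Q).1 hQ
  -- An isotropic vector in the radical of the polar form does not affect `Q`, so `V` is projected
  -- along it onto a hyperplane.
  by_cases hrad : ∀ y, QuadraticMap.polar Q x y = 0
  · obtain ⟨φ, hφ⟩ := Module.Projective.exists_dual_eq_one K hx0
    let W : Submodule K V := LinearMap.ker φ
    let π : V →ₗ[K] W := LinearMap.codRestrict W (LinearMap.id - φ.smulRight x) (by
      intro y; simp [W, hφ])
    have hπ : ∀ y, (π y : V) = y - φ y • x := fun y => rfl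
    have hlt : Module.finrank K W < n := by
      rw [← hn]
      refine Submodule.finrank_lt ?_
      intro h
      have : x ∈ W := h ▸ Submodule.mem_top
      simp [W, hφ] at this
    obtain ⟨k, t, N, f, hN, hf, hfQ⟩ := ih _ hlt (Q.restrict W) rfl
    refine ⟨k, t, N, f ∘ₗ π, hN, ?_, ?_⟩
    · refine hf.comp fun w => ⟨w, Subtype.ext ?_⟩
      have : φ (w : V) = 0 := w.2
      simp [hπ, this]
    · intro y
      rw [LinearMap.comp_apply, ← hfQ, QuadraticMap.restrict_apply, hπ, sub_eq_add_neg,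
        QuadraticMap.map_add Q, QuadraticMap.map_neg, QuadraticMap.map_smul,
        QuadraticMap.polar_neg_right, QuadraticMap.polar_smul_right, QuadraticMap.polar_comm, hrad,
        hx]
      simp
  · push Not at hrad
    obtain ⟨y₀, hy₀⟩ := hrad
    obtain ⟨y, hy, hxy⟩ := exists_hyperbolic_pair Q hx hy₀
    -- On the plane spanned by `x` and `y`, `u` reads the coefficient of `x` and `v` that of `y`;
    -- their common kernel `W` is the orthogonal complement.
    let u : Module.Dual K V := Q.polarBilin y
    let v : Module.Dual K V := Q.polarBilin x
    have hu : ∀ z, u z = QuadraticMap.polar Q y z := fun z => rfl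
    have hv : ∀ z, v z = QuadraticMap.polar Q x z := fun z => rfl
    have hux : u x = 1 := by rw [hu, QuadraticMap.polar_comm, hxy]
    have huy : u y = 0 := by rw [hu, QuadraticMap.polar_self, hy, smul_zero]
    have hvx : v x = 0 := by rw [hv, QuadraticMap.polar_self, hx, smul_zero]
    have hvy : v y = 1 := by rw [hv, hxy]
    let W : Submodule K V := LinearMap.ker u ⊓ LinearMap.ker v
    let π : V →ₗ[K] W := LinearMap.codRestrict W (LinearMap.id - u.smulRight x - v.smulRight y) (by
      intro z; simp [W, hux, huy, hvx, hvy])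
    have hπ : ∀ z, (π z : V) = z - u z • x - v z • y := fun z => rfl
    have hlt : Module.finrank K W < n := by
      rw [← hn]
      refine Submodule.finrank_lt ?_
      intro h
      have : x ∈ W := h ▸ Submodule.mem_top
      simp [W, hux] at this
    obtain ⟨k, t, N, f, hN, hf, hfQ⟩ := ih _ hlt (Q.restrict W) rfl
    have hQz : ∀ z, Q z = u z * v z + Q (π z) := by
      intro z
      have hz : z = (π z : V) + (u z • x + v z • y) := by rw [hπ]; abel
      have h1 : u (π z) = 0 := (π z).2.1
      have h2 : v (π z) = 0 := (π z).2.2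
      rw [hu, QuadraticMap.polar_comm] at h1
      rw [hv, QuadraticMap.polar_comm] at h2
      conv_lhs => rw [hz]
      rw [QuadraticMap.map_add Q, QuadraticMap.map_add Q, QuadraticMap.polar_add_right]
      simp only [QuadraticMap.map_smul, QuadraticMap.polar_smul_right,
        QuadraticMap.polar_smul_left, hx, hy, h1, h2, hxy, smul_eq_mul]
      ring
    refine ⟨k + 1, t, N,
      ((LinearMap.pi (Fin.cons u fun j => LinearMap.proj j ∘ₗ LinearMap.fst K _ _ ∘ₗ
          LinearMap.fst K _ _ ∘ₗ f ∘ₗ π)).prod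
        (LinearMap.pi (Fin.cons v fun j => LinearMap.proj j ∘ₗ LinearMap.snd K _ _ ∘ₗ
          LinearMap.fst K _ _ ∘ₗ f ∘ₗ π))).prod
        (LinearMap.snd K _ _ ∘ₗ f ∘ₗ π), hN, ?_, ?_⟩
    · rintro ⟨⟨a, b⟩, c⟩
      obtain ⟨w, hw⟩ := hf ((Fin.tail a, Fin.tail b), c)
      have h1 : u (w : V) = 0 := w.2.1
      have h2 : v (w : V) = 0 := w.2.2
      have hu' : u (w + a 0 • x + b 0 • y) = a 0 := by simp [h1, hux, huy]
      have hv' : v (w + a 0 • x + b 0 • y) = b 0 := by simp [h2, hvx, hvy]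
      have hπ' : π (w + a 0 • x + b 0 • y) = w := by
        apply Subtype.ext
        rw [hπ, hu', hv']
        abel
      refine ⟨w + a 0 • x + b 0 • y,
        Prod.ext (Prod.ext (funext fun i => ?_) (funext fun i => ?_)) ?_⟩
      · refine Fin.cases ?_ (fun j => ?_) i
        · exact hu'
        · change (f (π _)).1.1 j = _
          rw [hπ', hw]; rfl
      · refine Fin.cases ?_ (fun j => ?_) i
        · exact hv'
        · change (f (π _)).1.2 j = _
          rw [hπ', hw]; rfl
      · change (f (π _)).2 = _
        rw [hπ', hw]
    · intro z
      rw [hQz, ← QuadraticMap.restrict_apply, hfQ, wittForm_apply, wittForm_apply, Fin.sum_univ_succ]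
      simp [add_assoc]

/-! ### Anisotropic forms over finite fields -/

open Module in
/-- A quadratic form in at least three variables over a finite field has a nontrivial zero. -/
theorem finrank_le_two_of_anisotropic {K V : Type*} [Field K] [Finite K] [AddCommGroup V]
    [Module K V] [FiniteDimensional K V] (Q : QuadraticForm K V) (hQ : Q.Anisotropic) :
    finrank K V ≤ 2 := by
  classical
  by_contra! h
  have := Fintype.ofFinite K
  let b := finBasis K V
  obtain ⟨B, rfl⟩ := LinearMap.BilinMap.toQuadraticMap_surjective Q
  let p : MvPolynomial (Fin (finrank K V)) K :=
    ∑ i, ∑ j, MvPolynomial.C (B (b i) (b j)) * (MvPolynomial.X i * MvPolynomial.X j)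
  have hp : ∀ x, MvPolynomial.eval x p = B.toQuadraticMap (∑ i, x i • b i) := by
    intro x
    simp only [p, map_sum, map_mul, MvPolynomial.eval_C, MvPolynomial.eval_X,
      LinearMap.BilinMap.toQuadraticMap_apply, LinearMap.sum_apply, map_smul, LinearMap.smul_apply,
      smul_eq_mul]
    rw [Finset.sum_comm]
    refine Finset.sum_congr rfl fun i _ => ?_
    rw [Finset.mul_sum]
    exact Finset.sum_congr rfl fun j _ => by ring
  have hdeg : p.totalDegree ≤ 2 := by
    refine MvPolynomial.totalDegree_finsetSum_le fun i _ =>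
      MvPolynomial.totalDegree_finsetSum_le fun j _ => ?_
    refine (MvPolynomial.totalDegree_mul _ _).trans ?_
    have := MvPolynomial.totalDegree_mul (MvPolynomial.X i : MvPolynomial _ K) (MvPolynomial.X j)
    simp only [MvPolynomial.totalDegree_X, MvPolynomial.totalDegree_C] at this ⊢
    omega
  obtain ⟨c, hc⟩ := CharP.exists K
  -- Chevalley–Warning: with more variables than the degree, the characteristic divides the number
  -- of zeros, which anisotropy makes equal to one.
  have hdvd := char_dvd_card_solutions c (f := p) (by simpa using hdeg.trans_lt h)
  have hsol : ∀ x, MvPolynomial.eval x p = 0 ↔ x = 0 := by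
    intro x
    rw [hp, hQ.eq_zero_iff]
    constructor
    · intro hx
      exact funext (Fintype.linearIndependent_iff.1 b.linearIndependent x hx)
    · rintro rfl
      simp
  have hone : Fintype.card {x : Fin (finrank K V) → K // MvPolynomial.eval x p = 0} = 1 := by
    simp_rw [hsol]
    simp
  rw [hone, Nat.dvd_one] at hdvd
  exact CharP.char_ne_one K c hdvd

/-- An anisotropic form on a plane over a finite field represents every element. -/
theorem exists_apply_eq_of_anisotropic {K V : Type*} [Field K] [Finite K] [AddCommGroup V]
    [Module K V] [FiniteDimensional K V] (Q : QuadraticForm K V) (hQ : Q.Anisotropic)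
    (hV : Module.finrank K V = 2) (c : K) : ∃ x, Q x = c := by
  by_contra! h
  -- If `c` were not a value of `Q`, the form `Q x - c t²` in three variables would be anisotropic:
  -- a zero with `t ≠ 0` rescales to `t = 1`.
  let Q' : QuadraticForm K (V × K) :=
    Q.comp (LinearMap.fst K V K) - c • QuadraticMap.sq.comp (LinearMap.snd K V K)
  have hQ' : ∀ x t, Q' (x, t) = Q x - c * (t * t) := fun x t => rfl
  have : Q'.Anisotropic := by
    rintro ⟨x, t⟩ hx
    rw [hQ'] at hx
    by_cases ht : t = 0
    · subst ht
      have := hQ x (by simpa using hx)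
      simp [this]
    · refine absurd ?_ (h (t⁻¹ • x))
      rw [QuadraticMap.map_smul, sub_eq_zero.1 hx, smul_eq_mul]
      field_simp
  have := finrank_le_two_of_anisotropic Q' this
  simp [hV] at this

/-- The binary form `y² + a y z + b z²`. -/
def binaryForm {K : Type*} [Field K] (a b : K) : QuadraticForm K (Fin 2 → K) :=
  QuadraticMap.proj 0 0 + a • QuadraticMap.proj 0 1 + b • QuadraticMap.proj 1 1

theorem binaryForm_apply {K : Type*} [Field K] (a b : K) (x : Fin 2 → K) :
    binaryForm a b x = x 0 ^ 2 + a * x 0 * x 1 + b * x 1 ^ 2 := by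
  simp [binaryForm]
  ring

theorem binaryForm_anisotropic_iff {K : Type*} [Field K] (a b : K) :
    (binaryForm a b).Anisotropic ↔
      ∀ y z : K, y ^ 2 + a * y * z + b * z ^ 2 = 0 → y = 0 ∧ z = 0 := by
  constructor
  · intro h y z hyz
    have := h ![y, z] (by simpa [binaryForm_apply] using hyz)
    exact ⟨congrFun this 0, congrFun this 1⟩
  · intro h x hx
    rw [binaryForm_apply] at hx
    obtain ⟨h0, h1⟩ := h _ _ hx
    ext i
    fin_cases i
    · exact h0
    · exact h1

/-- An anisotropic form on a plane over a finite field is, in suitable coordinates, of the form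
`y² + a y z + b z²`. -/
theorem exists_equiv_binaryForm {K : Type*} [Field K] [Finite K]
    (N : QuadraticForm K (Fin 2 → K)) (hN : N.Anisotropic) :
    ∃ (a b : K) (e : (Fin 2 → K) ≃ₗ[K] (Fin 2 → K)), ∀ x, N x = binaryForm a b (e x) := by
  -- A first basis vector of value `1` makes the leading coefficient `1`.
  obtain ⟨x, hx⟩ := exists_apply_eq_of_anisotropic N hN (by simp) 1
  have hx0 : x ≠ 0 := by
    rintro rfl
    simp at hx
  obtain ⟨y, hy⟩ : ∃ y, LinearIndependent K ![x, y] :=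
    exists_linearIndependent_pair_of_one_lt_finrank (by simp) hx0
  let B := basisOfLinearIndependentOfCardEqFinrank hy (by simp)
  have hB : ⇑B = ![x, y] := coe_basisOfLinearIndependentOfCardEqFinrank _ _
  refine ⟨QuadraticMap.polar N x y, N y, B.equivFun, fun z => ?_⟩
  conv_lhs => rw [← B.sum_equivFun z]
  rw [Fin.sum_univ_two, hB, binaryForm_apply, QuadraticMap.map_add N]
  simp only [Matrix.cons_val_zero, Matrix.cons_val_one, QuadraticMap.map_smul,
    QuadraticMap.polar_smul_left, QuadraticMap.polar_smul_right, hx, smul_eq_mul]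
  ring

/-! ### Types 1 and 3 as Witt forms -/

/-- The independent family of functionals becomes one surjection onto a model space, the shape that
the rank and counting lemmas take as input. -/
theorem isTypeOne_iff_exists_wittForm {K F : Type*} [Field K] [Field F] [Algebra K F] {Q : F → K} :
    IsTypeOne K Q ↔ ∃ (k : ℕ) (f : F →ₗ[K] WittSpace K k 0), Function.Surjective f ∧
      ∀ x, Q x = wittForm k 0 (f x) := by
  constructor
  · rintro ⟨k, u, v, hli, hQ⟩
    rw [linearIndependent_sumElim_dual_iff_surjective] at hli
    refine ⟨k, LinearMap.inl K _ _ ∘ₗ (LinearMap.pi u).prod (LinearMap.pi v), ?_, ?_⟩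
    · rintro ⟨a, b⟩
      obtain ⟨x, hx⟩ := hli a
      exact ⟨x, Prod.ext hx (Subsingleton.elim _ _)⟩
    · intro x
      simp [wittForm_apply, hQ]
  · rintro ⟨k, f, hf, hQ⟩
    refine ⟨k, fun j => LinearMap.proj j ∘ₗ LinearMap.fst K _ _ ∘ₗ LinearMap.fst K _ _ ∘ₗ f,
      fun j => LinearMap.proj j ∘ₗ LinearMap.snd K _ _ ∘ₗ LinearMap.fst K _ _ ∘ₗ f, ?_, ?_⟩
    · rw [linearIndependent_sumElim_dual_iff_surjective]
      intro a
      obtain ⟨x, hx⟩ := hf (a, 0)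
      refine ⟨x, ?_⟩
      change (f x).1 = a
      rw [hx]
    · intro x
      simp [wittForm_apply, hQ]

theorem isTypeThree_iff_exists_wittForm {K F : Type*} [Field K] [Field F] [Algebra K F]
    {Q : F → K} : IsTypeThree K Q ↔ ∃ (k : ℕ) (a b : K) (f : F →ₗ[K] WittSpace K k 2),
      (binaryForm a b).Anisotropic ∧ Function.Surjective f ∧
      ∀ x, Q x = wittForm k (binaryForm a b) (f x) := by
  constructor
  · rintro ⟨k, u, v, e, a, b, hli, hab, hQ⟩
    rw [linearIndependent_sumElim_sumElim_dual_iff_surjective] at hli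
    refine ⟨k, a, b, _, (binaryForm_anisotropic_iff a b).2 hab, hli, ?_⟩
    intro x
    simp [wittForm_apply, hQ, binaryForm_apply]
  · rintro ⟨k, a, b, f, hab, hf, hQ⟩
    refine ⟨k, fun j => LinearMap.proj j ∘ₗ LinearMap.fst K _ _ ∘ₗ LinearMap.fst K _ _ ∘ₗ f,
      fun j => LinearMap.proj j ∘ₗ LinearMap.snd K _ _ ∘ₗ LinearMap.fst K _ _ ∘ₗ f,
      fun j => LinearMap.proj j ∘ₗ LinearMap.snd K _ _ ∘ₗ f, a, b, ?_,
      (binaryForm_anisotropic_iff a b).1 hab, ?_⟩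
    · rw [linearIndependent_sumElim_sumElim_dual_iff_surjective]
      exact hf
    · intro x
      simp [wittForm_apply, hQ, binaryForm_apply]

/-- A quadratic form of even rank over a finite field is of type `1` or of type `3`. -/
theorem isTypeOne_or_isTypeThree_of_even {K F : Type*} [Field K] [Finite K] [Field F] [Algebra K F]
    [FiniteDimensional K F] (Q : QuadraticForm K F) (h : Even (qfRank K Q)) :
    IsTypeOne K Q ∨ IsTypeThree K Q := by
  obtain ⟨k, t, N, f, hN, hf, hQ⟩ := exists_witt_decomposition _ Q rfl
  have hrank := qfRank_eq_finrank f hf (wittForm k N)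
    (fun x => wittForm_radical_of_anisotropic hN) hQ
  rw [finrank_wittSpace] at hrank
  have ht := finrank_le_two_of_anisotropic N hN
  rw [Module.finrank_fin_fun] at ht
  rw [hrank] at h
  -- The rank is `2k + t` with `t ≤ 2`, and evenness excludes `t = 1`.
  have ht' : t = 0 ∨ t = 2 := by
    rcases h with ⟨c, hc⟩
    omega
  rcases ht' with rfl | rfl
  · refine Or.inl (isTypeOne_iff_exists_wittForm.2 ⟨k, f, hf, ?_⟩)
    have hN0 : N = 0 := by
      ext x
      rw [Subsingleton.elim x 0, QuadraticMap.map_zero, QuadraticMap.map_zero]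
    rwa [hN0] at hQ
  · obtain ⟨a, b, e, he⟩ := exists_equiv_binaryForm N hN
    refine Or.inr (isTypeThree_iff_exists_wittForm.2 ⟨k, a, b,
      LinearMap.prodMap LinearMap.id e.toLinearMap ∘ₗ f, ?_, ?_, ?_⟩)
    · intro x hx
      simpa using hN (e.symm x) (by simpa [he] using hx)
    · rw [LinearMap.coe_comp, LinearMap.coe_prodMap]
      exact (Function.Surjective.prodMap Function.surjective_id e.surjective).comp hf
    · intro x
      simp [wittForm_apply, hQ, he]

/-! ### Value distribution of forms of types 1 and 3 -/

/-- If `G` grows linearly along a line, it takes all values equally often. -/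
theorem card_mul_card_fiber_of_translate {K V : Type*} [Field K] [AddCommGroup V] [Module K V]
    (G : V → K) (w : V) (hG : ∀ x (c : K), G (x + c • w) = G x + c) (d : K) :
    Nat.card K * Nat.card {x // G x = d} = Nat.card V := by
  rw [← Nat.card_prod]
  refine Nat.card_congr
    { toFun := fun p => p.2 + p.1 • w
      invFun := fun x => (G x - d, ⟨x - (G x - d) • w, ?_⟩)
      left_inv := ?_
      right_inv := ?_ }
  · rw [sub_eq_add_neg, ← neg_smul, hG]
    ring
  · rintro ⟨c, x, hx⟩
    ext <;> simp [hG, hx]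
  · intro x
    simp

theorem card_dotProduct_fiber {K : Type*} [Field K] [Finite K] {k : ℕ} (u : Fin k → K) (d : K)
    [Decidable (u = 0)] [Decidable (d = 0)] :
    (Nat.card {v : Fin k → K // ∑ j, u j * v j = d} : ℚ) =
      if u = 0 then (if d = 0 then (Nat.card K : ℚ) ^ k else 0)
      else (Nat.card K : ℚ) ^ k / Nat.card K := by
  split_ifs with hu hd
  · subst hu hd
    have : Nat.card {v : Fin k → K // ∑ j, (0 : Fin k → K) j * v j = 0} = Nat.card (Fin k → K) :=
      Nat.card_congr (Equiv.subtypeUnivEquiv (by simp))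
    rw [this, Nat.card_fun]
    simp
  · subst hu
    have : IsEmpty {v : Fin k → K // ∑ j, (0 : Fin k → K) j * v j = d} :=
      ⟨fun v => hd (by simpa using v.2.symm)⟩
    rw [Nat.card_of_isEmpty, Nat.cast_zero]
  · obtain ⟨i, hi⟩ := Function.ne_iff.1 hu
    have h := card_mul_card_fiber_of_translate (fun v : Fin k → K => ∑ j, u j * v j)
      (Pi.single i (u i)⁻¹) (by
        intro x c
        simp only [Pi.add_apply, Pi.smul_apply, smul_eq_mul, mul_add, Finset.sum_add_distrib]
        congr 1
        rw [Finset.sum_eq_single i]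
        · rw [Pi.single_eq_same, mul_left_comm, mul_inv_cancel₀ hi, mul_one]
        · intro j _ hj
          simp [hj]
        · simp) d
    have hq : (Nat.card K : ℚ) ≠ 0 := by exact_mod_cast Nat.card_pos.ne'
    rw [eq_div_iff hq, mul_comm]
    have h' : ((Nat.card K * Nat.card {v : Fin k → K // ∑ j, u j * v j = d} : ℕ) : ℚ)
        = Nat.card (Fin k → K) := by exact_mod_cast h
    rw [Nat.card_fun] at h'
    simpa using h'

/-- With `u` and `z` fixed, `v` solves the linear equation `u · v = a - N z`. For `u = 0` there are
`q^k` solutions or none, according to whether `N z = a`; each of the `q^k - 1` nonzero `u` gives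
`q^k / q` solutions for every `z`. -/
theorem card_wittForm_fiber {K : Type*} [Field K] [Finite K] (k : ℕ) {t : ℕ}
    (N : QuadraticForm K (Fin t → K)) (a : K) :
    (Nat.card {y // wittForm k N y = a} : ℚ) =
      (Nat.card K : ℚ) ^ k * Nat.card {z // N z = a} +
        (Nat.card K : ℚ) ^ t * ((Nat.card K : ℚ) ^ k - 1) * ((Nat.card K : ℚ) ^ k / Nat.card K) := by
  classical
  have := Fintype.ofFinite K
  let e : {y // wittForm k N y = a} ≃
      Σ p : (Fin k → K) × (Fin t → K), {v : Fin k → K // ∑ j, p.1 j * v j = a - N p.2} :=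
    { toFun := fun y => ⟨(y.1.1.1, y.1.2), y.1.1.2, by
        have := y.2
        rw [wittForm_apply] at this
        exact eq_sub_of_add_eq this⟩
      invFun := fun p => ⟨((p.1.1, p.2.1), p.1.2), by
        rw [wittForm_apply, p.2.2]
        ring⟩
      left_inv := fun y => rfl
      right_inv := fun p => rfl }
  rw [Nat.card_congr e, Nat.card_sigma, Nat.cast_sum]
  simp_rw [card_dotProduct_fiber]
  rw [Fintype.sum_prod_type, Finset.sum_comm]
  have hinner : ∀ z : Fin t → K, (∑ u : Fin k → K,
      if u = 0 then (if a - N z = 0 then (Nat.card K : ℚ) ^ k else 0)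
        else (Nat.card K : ℚ) ^ k / Nat.card K) =
      (if N z = a then (Nat.card K : ℚ) ^ k else 0) +
        ((Nat.card K : ℚ) ^ k - 1) * ((Nat.card K : ℚ) ^ k / Nat.card K) := by
    intro z
    rw [← Finset.add_sum_erase _ _ (Finset.mem_univ (0 : Fin k → K)), if_pos rfl]
    have : (a - N z = 0) = (N z = a) := propext (sub_eq_zero.trans eq_comm)
    simp_rw [this]
    congr 1
    rw [Finset.sum_congr rfl (g := fun _ => (Nat.card K : ℚ) ^ k / Nat.card K)
      fun u hu => if_neg (Finset.ne_of_mem_erase hu), Finset.sum_const,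
      Finset.card_erase_of_mem (Finset.mem_univ _), nsmul_eq_mul, Finset.card_univ,
      Nat.cast_sub Fintype.card_pos]
    simp
  rw [Finset.sum_congr rfl fun z _ => hinner z, Finset.sum_add_distrib, Finset.sum_const,
    ← Finset.sum_filter, Finset.sum_const, Nat.card_eq_fintype_card (α := {z // N z = a}),
    Fintype.card_subtype]
  simp
  ring

/-- Multiplication by `w` for the composition law of `y² + a y z + b z²`. -/
def binaryMul {K : Type*} [Field K] (a b : K) (w x : Fin 2 → K) : Fin 2 → K :=
  ![w 0 * x 0 - b * w 1 * x 1, w 0 * x 1 + w 1 * x 0 + a * w 1 * x 1]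

/-- The form is the norm of `y + zθ` in the quadratic algebra with `θ² = aθ - b`, and `binaryMul` is
the product there. -/
theorem binaryForm_binaryMul {K : Type*} [Field K] (a b : K) (w x : Fin 2 → K) :
    binaryForm a b (binaryMul a b w x) = binaryForm a b w * binaryForm a b x := by
  simp only [binaryForm_apply, binaryMul, Matrix.cons_val_zero, Matrix.cons_val_one]
  ring

theorem binaryMul_injective {K : Type*} [Field K] {a b : K} (hN : (binaryForm a b).Anisotropic)
    {w : Fin 2 → K} (hw : binaryForm a b w ≠ 0) : Function.Injective (binaryMul a b w) := by
  intro x y hxy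
  have h1 : binaryMul a b w (x - y) = 0 := by
    have h0 := congrFun hxy 0
    have h1 := congrFun hxy 1
    simp only [binaryMul, Matrix.cons_val_zero, Matrix.cons_val_one] at h0 h1
    ext i
    fin_cases i
    · simp only [binaryMul, Pi.sub_apply]
      change w 0 * (x 0 - y 0) - b * w 1 * (x 1 - y 1) = 0
      linear_combination h0
    · simp only [binaryMul, Pi.sub_apply]
      change w 0 * (x 1 - y 1) + w 1 * (x 0 - y 0) + a * w 1 * (x 1 - y 1) = 0
      linear_combination h1
  have h2 := binaryForm_binaryMul a b w (x - y)
  rw [h1, QuadraticMap.map_zero, eq_comm, mul_eq_zero] at h2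
  exact sub_eq_zero.1 (hN _ (h2.resolve_left hw))

/-- Multiplication by an element of norm `c` injects the fibre over `d` into the fibre over `c * d`.
-/
theorem card_binaryForm_fiber_le {K : Type*} [Field K] [Finite K] {a b : K}
    (hN : (binaryForm a b).Anisotropic) {c : K} (hc : c ≠ 0) (d : K) :
    Nat.card {x // binaryForm a b x = d} ≤ Nat.card {x // binaryForm a b x = c * d} := by
  obtain ⟨w, hw⟩ := exists_apply_eq_of_anisotropic _ hN (by simp) c
  refine Nat.card_le_card_of_injective
    (fun x => ⟨binaryMul a b w x, by rw [binaryForm_binaryMul, hw, x.2]⟩) ?_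
  intro x y hxy
  exact Subtype.ext (binaryMul_injective hN (hw ▸ hc) (congrArg Subtype.val hxy))

/-- All nonzero values have fibres of equal size, and `0` is taken only at the origin; so `q² - 1`
vectors are shared equally by `q - 1` values. -/
theorem card_binaryForm_fiber {K : Type*} [Field K] [Finite K] {a b : K}
    (hN : (binaryForm a b).Anisotropic) (c : K) [Decidable (c = 0)] :
    Nat.card {x // binaryForm a b x = c} = if c = 0 then 1 else Nat.card K + 1 := by
  classical
  have := Fintype.ofFinite K
  have h0 : Nat.card {x // binaryForm a b x = 0} = 1 := by
    simp_rw [hN.eq_zero_iff]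
    simp
  split_ifs with hc
  · rw [hc, h0]
  have heq : ∀ d : K, d ≠ 0 → Nat.card {x // binaryForm a b x = d} =
      Nat.card {x // binaryForm a b x = c} := by
    intro d hd
    apply le_antisymm
    · have := card_binaryForm_fiber_le hN (div_ne_zero hc hd) d
      rwa [div_mul_cancel₀ _ hd] at this
    · have := card_binaryForm_fiber_le hN (div_ne_zero hd hc) c
      rwa [div_mul_cancel₀ _ hc] at this
  have hsum : Nat.card (Fin 2 → K) = ∑ d : K, Nat.card {x // binaryForm a b x = d} := by
    rw [← Nat.card_sigma]
    exact Nat.card_congr (Equiv.sigmaFiberEquiv _).symm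
  rw [← Finset.add_sum_erase _ _ (Finset.mem_univ (0 : K)), h0,
    Finset.sum_congr rfl fun d hd => heq d (Finset.ne_of_mem_erase hd), Finset.sum_const,
    Finset.card_erase_of_mem (Finset.mem_univ _), Finset.card_univ, Nat.card_fun, smul_eq_mul,
    Nat.card_eq_fintype_card (α := Fin 2), Fintype.card_fin, ← Nat.card_eq_fintype_card] at hsum
  have hq : 1 < Nat.card K := Finite.one_lt_card
  obtain ⟨r, hr⟩ := Nat.exists_eq_add_of_lt hq
  rw [hr] at hsum ⊢
  have hr' : 1 + r + 1 - 1 = r + 1 := by omega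
  rw [hr'] at hsum
  have : (r + 1) * Nat.card {x // binaryForm a b x = c} = (r + 1) * (1 + r + 1 + 1) := by
    nlinarith
  exact Nat.eq_of_mul_eq_mul_left (by omega) this

theorem polar_binaryForm {K : Type*} [Field K] (a b : K) (x y : Fin 2 → K) :
    QuadraticMap.polar (binaryForm a b) x y =
      2 * x 0 * y 0 + a * (x 0 * y 1 + x 1 * y 0) + 2 * b * x 1 * y 1 := by
  simp only [QuadraticMap.polar, binaryForm_apply, Pi.add_apply]
  ring

/-- The discriminant of an anisotropic binary form over a finite field is nonzero. -/
theorem discr_ne_zero_of_anisotropic {K : Type*} [Field K] [Finite K] {a b : K}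
    (hN : (binaryForm a b).Anisotropic) : 4 * b - a ^ 2 ≠ 0 := by
  rw [binaryForm_anisotropic_iff] at hN
  intro h
  -- If the discriminant vanished, there would be a nontrivial zero: `(c, 1)` with `b = c²` in
  -- characteristic 2, where `a = 0`, and `(-a, 2)` otherwise.
  by_cases h2 : (2 : K) = 0
  · have ha : a = 0 := by
      have : a ^ 2 = 0 := by linear_combination 2 * b * h2 - h
      exact pow_eq_zero_iff two_ne_zero |>.1 this
    have : CharP K 2 := CharTwo.of_one_ne_zero_of_two_eq_zero one_ne_zero h2
    obtain ⟨c, hc⟩ := FiniteField.isSquare_of_char_two (ringChar.eq K 2 ▸ rfl) b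
    have := (hN c 1 (by rw [ha, hc]; linear_combination c ^ 2 * h2)).2
    exact one_ne_zero this
  · exact h2 (hN (-a) 2 (by linear_combination h)).2

/-- Pairing with the two basis vectors gives a linear system of determinant `4b - a²`. -/
theorem polar_binaryForm_nondegenerate {K : Type*} [Field K] [Finite K] {a b : K}
    (hN : (binaryForm a b).Anisotropic) {x : Fin 2 → K}
    (hx : ∀ y, QuadraticMap.polar (binaryForm a b) x y = 0) : x = 0 := by
  have h0 := hx ![1, 0]
  have h1 := hx ![0, 1]
  rw [polar_binaryForm] at h0 h1
  simp at h0 h1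
  have hd := discr_ne_zero_of_anisotropic hN
  have e0 : (4 * b - a ^ 2) * x 0 = 0 := by linear_combination 2 * b * h0 - a * h1
  have e1 : (4 * b - a ^ 2) * x 1 = 0 := by linear_combination 2 * h1 - a * h0
  ext i
  fin_cases i
  · exact (mul_eq_zero.1 e0).resolve_left hd
  · exact (mul_eq_zero.1 e1).resolve_left hd

/-- A form of type `1` or `3` factors through a nondegenerate form whose values are known to be
distributed as stated. -/
theorem HasTypeIndex.exists_factor {K F : Type*} [Field K] [Finite K] [Field F] [Algebra K F]
    {Q : F → K} {i : ℕ} (hQi : HasTypeIndex K Q i) :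
    ∃ (k t h : ℕ) (N : QuadraticForm K (Fin t → K)) (f : F →ₗ[K] WittSpace K k t),
      2 * k + t = 2 * h ∧ (i = 1 ∨ i = 2) ∧ Function.Surjective f ∧
      (∀ x, (∀ y, QuadraticMap.polar (wittForm k N) x y = 0) → x = 0) ∧
      (∀ x, Q x = wittForm k N (f x)) ∧
      ∀ (a : K) [Decidable (a = 0)], (Nat.card {y // wittForm k N y = a} : ℚ) =
        (Nat.card K : ℚ) ^ ((2 * h : ℤ) - 1) + (-1) ^ (i + 1) *
          (if a = 0 then ((Nat.card K : ℚ) - 1) * (Nat.card K : ℚ) ^ ((h : ℤ) - 1)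
            else -(Nat.card K : ℚ) ^ ((h : ℤ) - 1)) := by
  have hq : (Nat.card K : ℚ) ≠ 0 := by exact_mod_cast Nat.card_pos.ne'
  match i, hQi with
  | 1, hQi =>
    obtain ⟨k, f, hf, hfQ⟩ := isTypeOne_iff_exists_wittForm.1 hQi
    -- Here `h = k`. For `k = 0` the integer exponents are `-1`, and the formula still gives `1` at
    -- `a = 0` and `0` elsewhere.
    refine ⟨k, 0, k, 0, f, rfl, Or.inl rfl, hf, ?_, hfQ, ?_⟩
    · intro x hx
      exact Prod.ext (fst_eq_zero_of_polar_wittForm hx) (Subsingleton.elim _ _)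
    · intro a _
      have hcard : Nat.card {z : Fin 0 → K // (0 : QuadraticForm K (Fin 0 → K)) z = a} =
          if a = 0 then 1 else 0 := by
        split_ifs with ha
        · simp [ha]
        · have : IsEmpty {z : Fin 0 → K // (0 : QuadraticForm K (Fin 0 → K)) z = a} :=
            ⟨fun z => ha z.2.symm⟩
          simp
      rw [card_wittForm_fiber, hcard, zpow_sub_one₀ hq, zpow_sub_one₀ hq, two_mul, zpow_add₀ hq,
        zpow_natCast]
      split_ifs <;> field_simp <;> push_cast <;> ring
  | 2, hQi =>
    obtain ⟨k, a, b, f, hN, hf, hfQ⟩ := isTypeThree_iff_exists_wittForm.1 hQi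
    -- The anisotropic plane counts as one more pair of variables and turns the sign into `-1`.
    refine ⟨k, 2, k + 1, binaryForm a b, f, by ring, Or.inr rfl, hf, ?_, hfQ, ?_⟩
    · intro x hx
      exact Prod.ext (fst_eq_zero_of_polar_wittForm hx)
        (polar_binaryForm_nondegenerate hN (snd_polar_eq_zero_of_polar_wittForm hx))
    · intro c _
      rw [card_wittForm_fiber, card_binaryForm_fiber hN, zpow_sub_one₀ hq, zpow_sub_one₀ hq,
        two_mul, zpow_add₀ hq, zpow_natCast]
      split_ifs <;> field_simp <;> push_cast <;> ring

/-! ### Zeros of a quadratic form plus an affine function -/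

theorem card_subtype_comp_of_surjective {K V X : Type*} [Field K] [AddCommGroup V] [Module K V]
    [AddCommGroup X] [Module K X] (f : V →ₗ[K] X) (hf : Function.Surjective f) (p : X → Prop) :
    Nat.card {x // p (f x)} = Nat.card (LinearMap.ker f) * Nat.card {y // p y} := by
  obtain ⟨g, hg⟩ := f.exists_rightInverse_of_surjective (LinearMap.range_eq_top.2 hf)
  have hg' : ∀ y, f (g y) = y := fun y => LinearMap.congr_fun hg y
  rw [← Nat.card_prod]
  exact Nat.card_congr
    { toFun := fun x => (⟨x - g (f x), by simp [hg']⟩, ⟨f x, x.2⟩)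
      invFun := fun z => ⟨z.1 + g z.2, by
        have : f z.1 = 0 := z.1.2
        rw [map_add, this, hg', zero_add]
        exact z.2.2⟩
      left_inv := fun x => by simp
      right_inv := fun z => by
        have : f z.1 = 0 := z.1.2
        ext <;> simp [hg', this] }

theorem card_ker_of_surjective {K V X : Type*} [Field K] [Finite K] [AddCommGroup V] [Module K V]
    [AddCommGroup X] [Module K X] [FiniteDimensional K V] (f : V →ₗ[K] X)
    (hf : Function.Surjective f) :
    Nat.card (LinearMap.ker f) = Nat.card K ^ (Module.finrank K V - Module.finrank K X) := by
  rw [Module.natCard_eq_pow_finrank (K := K)]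
  congr 1
  have h := LinearMap.finrank_range_add_finrank_ker f
  rw [LinearMap.range_eq_top.2 hf, finrank_top] at h
  omega

/-- Completing the square without dividing by 2: `P (y + c) = P y + P c + polar P c y`. -/
theorem card_add_polar_eq_zero {K X : Type*} [Field K] [AddCommGroup X] [Module K X]
    (P : QuadraticForm K X) (c : X) (b : K) :
    Nat.card {y // P y + QuadraticMap.polar P c y + b = 0} = Nat.card {y // P y = P c - b} := by
  refine Nat.card_congr ((Equiv.addRight c).subtypeEquiv fun y => ?_)
  rw [Equiv.coe_addRight, QuadraticMap.map_add P, QuadraticMap.polar_comm P y c]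
  constructor
  · intro h
    linear_combination h
  · intro h
    linear_combination h

theorem bijective_polarBilin {K X : Type*} [Field K] [AddCommGroup X] [Module K X]
    [FiniteDimensional K X] (P : QuadraticForm K X)
    (hP : ∀ x, (∀ y, QuadraticMap.polar P x y = 0) → x = 0) :
    Function.Bijective P.polarBilin := by
  have hinj : Function.Injective P.polarBilin := by
    rw [injective_iff_map_eq_zero]
    intro x hx
    exact hP x fun y => LinearMap.congr_fun hx y
  refine ⟨hinj, ?_⟩
  have hfin : Module.finrank K X = Module.finrank K (X →ₗ[K] K) :=
    (Subspace.dual_finrank_eq (K := K) (V := X)).symm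
  exact (LinearMap.injective_iff_surjective_of_finrank_eq_finrank hfin).1 hinj

/-- The number of zeros of `Q + Tr(β ·) + b`, where `Q` factors through a nondegenerate form `P`,
is known for each `β`: here summed over `β`, against an arbitrary function `T`. -/
theorem sum_card_zeros_add_trace {K F X : Type*} [Field K] [Finite K] [Field F] [Fintype F]
    [Algebra K F] [AddCommGroup X] [Module K X] [Fintype X] {Q : F → K} (f : F →ₗ[K] X)
    (hf : Function.Surjective f) (P : QuadraticForm K X)
    (hP : ∀ x, (∀ y, QuadraticMap.polar P x y = 0) → x = 0) (hQ : ∀ x, Q x = P (f x))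
    (b : K) (T : ℕ → ℚ) :
    ∑ β : F, T (Nat.card {x // Q x + Algebra.trace K F (β * x) + b = 0}) =
      ((Nat.card K : ℚ) ^ Module.finrank K F - (Nat.card K : ℚ) ^ Module.finrank K X) *
        T (Nat.card K ^ (Module.finrank K F - 1)) +
      ∑ c : X, T (Nat.card K ^ (Module.finrank K F - Module.finrank K X) *
        Nat.card {y // P y = P c - b}) := by
  classical
  have : FiniteDimensional K F := Module.Finite.of_finite
  have : FiniteDimensional K X := Module.Finite.of_finite
  let e := (Algebra.traceForm K F).toDual (traceForm_nondegenerate K F)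
  have he : ∀ β x, e β x = Algebra.trace K F (β * x) := fun β x => by
    rw [LinearMap.BilinForm.toDual_def, Algebra.traceForm_apply]
  -- `Φ c` represents `polar P c ∘ f` through the trace form; the image of `Φ` consists of the `β`
  -- for which `Tr(β ·)` vanishes on `ker f`.
  let Φ : X → F := fun c => e.symm (P.polarBilin c ∘ₗ f)
  have hΦ : ∀ c x, Algebra.trace K F (Φ c * x) = QuadraticMap.polar P c (f x) := by
    intro c x
    rw [← he, LinearEquiv.apply_symm_apply]
    rfl
  have hbij := bijective_polarBilin P hP
  have hΦinj : Function.Injective Φ := by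
    intro c d hcd
    apply hbij.1
    have := e.symm.injective hcd
    ext y
    obtain ⟨x, rfl⟩ := hf y
    exact LinearMap.congr_fun this x
  rw [← Finset.sum_compl_add_sum (Finset.univ.image Φ), Finset.sum_image (fun c _ d _ h => hΦinj h)]
  congr 1
  · have hval : ∀ β ∈ (Finset.univ.image Φ)ᶜ,
        Nat.card {x // Q x + Algebra.trace K F (β * x) + b = 0} =
          Nat.card K ^ (Module.finrank K F - 1) := by
      intro β hβ
      -- Otherwise `Tr(β ·)` would descend to `X` along a section of `f`, and nondegeneracy of `P`
      -- would put `β` in the image. Translation by `w` fixes `Q` but shifts the trace, so all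
      -- values are equally frequent.
      obtain ⟨w, hw, hβw⟩ : ∃ w, f w = 0 ∧ Algebra.trace K F (β * w) ≠ 0 := by
        by_contra! hcon
        obtain ⟨g, hg⟩ := f.exists_rightInverse_of_surjective (LinearMap.range_eq_top.2 hf)
        obtain ⟨c, hc⟩ := hbij.2 (e β ∘ₗ g)
        refine absurd ?_ (Finset.mem_compl.1 hβ)
        refine Finset.mem_image.2 ⟨c, Finset.mem_univ _, ?_⟩
        apply e.injective
        rw [LinearEquiv.apply_symm_apply, hc]
        ext x
        have := hcon (g (f x) - x) (by
          rw [map_sub, sub_eq_zero]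
          exact LinearMap.congr_fun hg (f x))
        rw [← he, map_sub, sub_eq_zero] at this
        exact this
      have hcount := card_mul_card_fiber_of_translate
        (fun x => Q x + Algebra.trace K F (β * x) + b) ((Algebra.trace K F (β * w))⁻¹ • w) (by
          intro x c
          rw [hQ, hQ, map_add, map_smul, map_smul, hw, smul_zero, smul_zero, add_zero, mul_add,
            map_add, mul_smul_comm, mul_smul_comm, map_smul, map_smul, smul_eq_mul, smul_eq_mul,
            inv_mul_cancel₀ hβw]
          ring) 0
      have hm : 0 < Module.finrank K F := Module.finrank_pos
      have hqm : Nat.card F = Nat.card K * Nat.card K ^ (Module.finrank K F - 1) := by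
        rw [← pow_succ', Nat.sub_add_cancel hm, Module.natCard_eq_pow_finrank (K := K)]
      rw [hqm] at hcount
      exact Nat.eq_of_mul_eq_mul_left Nat.card_pos hcount
    rw [Finset.sum_congr rfl fun β hβ => by rw [hval β hβ], Finset.sum_const, nsmul_eq_mul,
      Finset.card_compl, Nat.cast_sub (Finset.card_le_univ _),
      Finset.card_image_of_injective _ hΦinj, Finset.card_univ, ← Nat.card_eq_fintype_card,
      ← Nat.card_eq_fintype_card, Module.natCard_eq_pow_finrank (K := K) (V := F),
      Module.natCard_eq_pow_finrank (K := K) (V := X)]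
    push_cast
    rfl
  · refine Finset.sum_congr rfl fun c _ => ?_
    congr 1
    rw [← card_ker_of_surjective f hf, ← card_add_polar_eq_zero,
      ← card_subtype_comp_of_surjective f hf]
    simp_rw [hΦ, hQ]

/-- The factorization through a nondegenerate form on a space of dimension `r = 2 h` and the value
distribution of that form determine the distribution of the number of zeros. -/
theorem HasTypeIndex.sum_card_zeros {K F : Type*} [Field K] [Finite K] [Field F] [Fintype F]
    [Algebra K F] {Q : F → K} {i : ℕ} (hQi : HasTypeIndex K Q i) :
    ∃ h : ℕ, qfRank K Q = 2 * h ∧ 2 * h ≤ Module.finrank K F ∧ (i = 1 ∨ i = 2) ∧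
      ∀ (b : K) [Decidable (b = 0)] (q : ℚ), q = Nat.card K → ∀ T : ℚ → ℚ,
        ∑ β : F, T (Nat.card {x // Q x + Algebra.trace K F (β * x) + b = 0}) =
        (q ^ Module.finrank K F - q ^ (2 * h)) * T (q ^ ((Module.finrank K F : ℤ) - 1)) +
        (q ^ ((2 * h : ℤ) - 1) + (-1) ^ (i + 1) * (if b = 0 then (q - 1) * q ^ ((h : ℤ) - 1)
            else -q ^ ((h : ℤ) - 1))) *
          T (q ^ ((Module.finrank K F : ℤ) - 1)
            + (-1) ^ (i + 1) * ((q - 1) * q ^ ((Module.finrank K F : ℤ) - h - 1))) +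
        (q ^ (2 * h) - (q ^ ((2 * h : ℤ) - 1) +
          (-1) ^ (i + 1) * (if b = 0 then (q - 1) * q ^ ((h : ℤ) - 1)
            else -q ^ ((h : ℤ) - 1)))) *
          T (q ^ ((Module.finrank K F : ℤ) - 1)
            - (-1) ^ (i + 1) * q ^ ((Module.finrank K F : ℤ) - h - 1)) := by
  classical
  have := Fintype.ofFinite K
  have : FiniteDimensional K F := Module.Finite.of_finite
  obtain ⟨k, t, h, N, f, hkt, hi, hf, hP, hQ, hZ⟩ := hQi.exists_factor
  have hrX : Module.finrank K (WittSpace K k t) = 2 * h := by rw [finrank_wittSpace, hkt]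
  have hle : 2 * h ≤ Module.finrank K F := by
    rw [← hrX]
    exact LinearMap.finrank_le_finrank_of_surjective hf
  refine ⟨h, ?_, hle, hi, ?_⟩
  · rw [← hrX]
    exact qfRank_eq_finrank f hf _ (fun x _ => hP x) hQ
  intro b _ q hq T
  have hq0 : q ≠ 0 := by
    rw [hq]
    exact_mod_cast Nat.card_pos.ne'
  rw [sum_card_zeros_add_trace f hf _ hP hQ b (fun n => T n), hrX]
  simp only [Nat.cast_mul, Nat.cast_pow, hZ, ← hq]
  have hm : 0 < Module.finrank K F := Module.finrank_pos
  generalize hmm : Module.finrank K F = m at *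
  have hpow1 : q ^ (m - 1) = q ^ ((m : ℤ) - 1) := by
    rw [← zpow_natCast, Nat.cast_sub hm, Nat.cast_one]
  have hpow2 : q ^ (m - 2 * h) = q ^ ((m : ℤ) - 2 * h) := by
    rw [← zpow_natCast, Nat.cast_sub hle]
    push_cast
    rfl
  have hmul1 : q ^ ((m : ℤ) - 2 * h) * q ^ ((2 * h : ℤ) - 1) = q ^ ((m : ℤ) - 1) := by
    rw [← zpow_add₀ hq0]
    congr 1
    ring
  have hmul2 : q ^ ((m : ℤ) - 2 * h) * q ^ ((h : ℤ) - 1) = q ^ ((m : ℤ) - h - 1) := by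
    rw [← zpow_add₀ hq0]
    congr 1
    ring
  -- The number of zeros depends on `c` only through whether `P c = b`. Counting those `c` uses the
  -- value distribution of `P` a second time.
  have hterm : ∀ c : WittSpace K k t,
      T (q ^ (m - 2 * h) * (q ^ ((2 * h : ℤ) - 1) + (-1) ^ (i + 1) *
          (if wittForm k N c - b = 0 then (q - 1) * q ^ ((h : ℤ) - 1) else -q ^ ((h : ℤ) - 1)))) =
      if wittForm k N c = b then
        T (q ^ ((m : ℤ) - 1) + (-1) ^ (i + 1) * ((q - 1) * q ^ ((m : ℤ) - h - 1)))
      else T (q ^ ((m : ℤ) - 1) - (-1) ^ (i + 1) * q ^ ((m : ℤ) - h - 1)) := by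
    intro c
    simp only [sub_eq_zero]
    rw [hpow2]
    split_ifs
    · congr 1
      linear_combination hmul1 + (-1) ^ (i + 1) * (q - 1) * hmul2
    · congr 1
      linear_combination hmul1 - (-1) ^ (i + 1) * hmul2
  rw [Finset.sum_congr rfl fun c _ => hterm c, Finset.sum_ite, Finset.sum_const, Finset.sum_const,
    nsmul_eq_mul, nsmul_eq_mul, hpow1]
  have hcard : ((Finset.univ.filter fun c => wittForm k N c = b).card : ℚ) =
      q ^ ((2 * h : ℤ) - 1) + (-1) ^ (i + 1) * (if b = 0 then (q - 1) * q ^ ((h : ℤ) - 1)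
            else -q ^ ((h : ℤ) - 1)) := by
    rw [← Fintype.card_subtype, ← Nat.card_eq_fintype_card, hZ, hq]
  have hcard' : ((Finset.univ.filter fun c => ¬ wittForm k N c = b).card : ℚ) =
      q ^ (2 * h) - ((Finset.univ.filter fun c => wittForm k N c = b).card : ℚ) := by
    rw [eq_sub_iff_add_eq, hq, ← Nat.cast_pow, ← hrX, ← Module.natCard_eq_pow_finrank (K := K),
      ← Nat.cast_add, add_comm, Finset.card_filter_add_card_filter_not, Finset.card_univ,
      Nat.card_eq_fintype_card]
  rw [hcard', hcard]
  ring

/-! ### Linearized polynomials and their trace forms -/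

section LinearizedPolynomials

variable {K F : Type*} [Field K] [Fintype K] [Field F] {s : ℕ} {ℓ : Fin s → ℕ}

theorem mem_linearizedSpan_iff {R : F[X]} : R ∈ linearizedSpan K F ℓ ↔
    ∃ a : Fin s → F, R = ∑ i, a i • (X : F[X]) ^ (Fintype.card K ^ ℓ i) := by
  rw [linearizedSpan, ← Fintype.range_linearCombination]
  simp only [LinearMap.mem_range, Fintype.linearCombination_apply, eq_comm]

theorem linearIndependent_X_pow_card_pow (hℓ : Function.Injective ℓ) :
    LinearIndependent F fun i => (X : F[X]) ^ (Fintype.card K ^ ℓ i) := by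
  have hinj : Function.Injective fun i => Fintype.card K ^ ℓ i :=
    (Nat.pow_right_injective (Fintype.one_lt_card (α := K))).comp hℓ
  have := (Polynomial.basisMonomials F).linearIndependent.comp _ hinj
  convert this using 2 with i
  simp [Polynomial.X_pow_eq_monomial]

theorem finrank_linearizedSpan (hℓ : Function.Injective ℓ) :
    Module.finrank F (linearizedSpan K F ℓ) = s := by
  rw [linearizedSpan, finrank_span_eq_card (linearIndependent_X_pow_card_pow hℓ), Fintype.card_fin]

instance : FiniteDimensional F (linearizedSpan K F ℓ) := by
  rw [linearizedSpan]
  exact FiniteDimensional.span_of_finite F (Set.finite_range _)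

instance [Finite F] : Finite (linearizedSpan K F ℓ) := Module.finite_of_finite F

variable [Algebra K F]

theorem exists_linearMap_eq_eval {R : F[X]} (hR : R ∈ linearizedSpan K F ℓ) :
    ∃ g : F →ₗ[K] F, ∀ x, g x = R.eval x := by
  obtain ⟨a, rfl⟩ := mem_linearizedSpan_iff.1 hR
  refine ⟨∑ i, a i • ((FiniteField.frobeniusAlgHom K F) ^ ℓ i).toLinearMap, fun x => ?_⟩
  simp [eval_finsetSum, AlgHom.coe_pow, FiniteField.coe_frobeniusAlgHom, pow_iterate]

theorem exists_quadraticForm_eq_traceForm {R : F[X]} (hR : R ∈ linearizedSpan K F ℓ) :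
    ∃ Q : QuadraticForm K F, ⇑Q = traceForm K R := by
  obtain ⟨g, hg⟩ := exists_linearMap_eq_eval hR
  refine ⟨LinearMap.BilinMap.toQuadraticMap ((Algebra.traceForm K F).compRight g), ?_⟩
  ext x
  simp [traceForm, hg, Algebra.traceForm_apply]

variable [Fintype F]

theorem trace_pow_card_pow (x : F) (n : ℕ) :
    Algebra.trace K F (x ^ (Fintype.card K ^ n)) = Algebra.trace K F x := by
  have : FiniteDimensional K F := Module.Finite.of_finite
  rw [← Algebra.trace_eq_of_algEquiv ((FiniteField.frobeniusAlgEquivOfAlgebraic K F) ^ n) x,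
    AlgEquiv.coe_pow, FiniteField.coe_frobeniusAlgEquivOfAlgebraic_iterate]

theorem eq_zero_of_trace_mul_eq_zero {z : F} (h : ∀ y, Algebra.trace K F (z * y) = 0) :
    z = 0 := by
  have : FiniteDimensional K F := Module.Finite.of_finite
  exact (traceForm_nondegenerate K F).1 z h

/-- A linearized polynomial with exponents below `m / 2` is determined by the polar form of its
trace form. -/
theorem eq_zero_of_polar_traceForm_eq_zero (hℓ : Function.Injective ℓ)
    (hℓ_pos : ∀ i, 1 ≤ ℓ i) (hℓ_lt : ∀ i, 2 * ℓ i < Module.finrank K F) {R : F[X]}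
    (hR : R ∈ linearizedSpan K F ℓ)
    (h : ∀ x y, Algebra.trace K F (x * R.eval y) + Algebra.trace K F (y * R.eval x) = 0) :
    R = 0 := by
  classical
  have : FiniteDimensional K F := Module.Finite.of_finite
  obtain ⟨a, rfl⟩ := mem_linearizedSpan_iff.1 hR
  set q := Fintype.card K with hq
  set m := Module.finrank K F with hm
  have hq1 : 1 < q := Fintype.one_lt_card
  have hcard : Fintype.card F = q ^ m := Module.card_eq_pow_finrank
  -- `S` is `R` plus its adjoint: raising to the power `q^(m - ℓ i)` inside the trace turns `y^(q^ℓ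
  -- i)` into `y^(q^m) = y`.
  let S : F[X] := ∑ i, (C (a i) * X ^ q ^ ℓ i + C (a i ^ q ^ (m - ℓ i)) * X ^ q ^ (m - ℓ i))
  have hadj : ∀ i x y, Algebra.trace K F (x * (a i * y ^ q ^ ℓ i)) =
      Algebra.trace K F ((a i ^ q ^ (m - ℓ i) * x ^ q ^ (m - ℓ i)) * y) := by
    intro i x y
    rw [← trace_pow_card_pow _ (m - ℓ i), ← hq, mul_pow, mul_pow, ← pow_mul, ← pow_add,
      Nat.add_sub_cancel' (by have := hℓ_lt i; omega), ← hcard, FiniteField.pow_card]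
    congr 1
    ring
  have hS : ∀ x, S.eval x = 0 := by
    intro x
    refine eq_zero_of_trace_mul_eq_zero (K := K) fun y => ?_
    rw [← h x y]
    simp only [S, eval_finsetSum, eval_add, eval_mul, eval_C, eval_pow, eval_X, eval_smul,
      smul_eq_mul, Finset.mul_sum, Finset.sum_mul, map_sum, hadj, add_mul, map_add,
      Finset.sum_add_distrib]
    rw [add_comm]
    congr 1
    refine Finset.sum_congr rfl fun i _ => ?_
    rw [← hadj, mul_comm]
  have hS0 : S = 0 := by
    refine eq_zero_of_natDegree_lt_card_of_eval_eq_zero S Function.injective_id hS ?_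
    -- Since `ℓ i ≥ 1`, the adjoint exponents `m - ℓ i` stay below `m`, so `S` has degree less than
    -- `|F|` and cannot vanish on `F` unless it is zero.
    have hdeg : S.natDegree ≤ q ^ (m - 1) := by
      refine natDegree_sum_le_of_forall_le _ _ fun i _ => natDegree_add_le_of_degree_le ?_ ?_
      · refine (natDegree_C_mul_X_pow_le _ _).trans (Nat.pow_le_pow_right hq1.le ?_)
        have := hℓ_lt i
        omega
      · refine (natDegree_C_mul_X_pow_le _ _).trans (Nat.pow_le_pow_right hq1.le ?_)
        have := hℓ_pos i
        omega
    rw [hcard]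
    refine hdeg.trans_lt (Nat.pow_lt_pow_right hq1 ?_)
    have : 0 < m := Module.finrank_pos
    omega
  have hcoeff : ∀ j, a j = 0 := by
    intro j
    have := congrArg (fun p => coeff p (q ^ ℓ j)) hS0
    simp only [S, finsetSum_coeff, coeff_add, coeff_C_mul, coeff_X_pow, coeff_zero] at this
    -- As `ℓ j < m/2 < m - ℓ i` for all `i`, no adjoint term reaches the coefficient of `X^(q^ℓ j)`.
    rw [Finset.sum_eq_single j] at this
    · rw [if_pos rfl, if_neg] at this
      · simpa using this
      · intro h'
        have := Nat.pow_right_injective hq1 h'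
        have := hℓ_lt j
        omega
    · intro i _ hij
      rw [if_neg, if_neg]
      · simp
      · intro h'
        have := Nat.pow_right_injective hq1 h'
        have := hℓ_lt j
        have := hℓ_lt i
        omega
      · intro h'
        exact hij (hℓ (Nat.pow_right_injective hq1 h')).symm
    · simp
  simp [hcoeff]

end LinearizedPolynomials

/-! ### Cyclicity, dimensions and weights of words -/

section Codes

variable {K F : Type*} [Field K] [Field F] [Algebra K F]

theorem codeword_sub (R R' : F[X]) (β β' : F) (b b' : K) :
    codeword K (R - R') (β - β') (b - b') = codeword K R β b - codeword K R' β' b' := by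
  rw [eq_sub_iff_add_eq, ← codeword_add, sub_add_cancel, sub_add_cancel, sub_add_cancel]

theorem codeword_apply_eq (R : F[X]) (β : F) (b : K) (x : Fˣ) :
    codeword K R β b x = traceForm K R x + Algebra.trace K F (β * x) + b := by
  simp [codeword, traceForm]

/-- The point `0` is not a coordinate, so a nonzero value there is lost from the weight. This
produces the `-1` in the weights of words with `b ≠ 0`. -/
theorem hammingNorm_units_add_card_zeros {K F : Type*} [Field K] [Field F] [DecidableEq K]
    [Fintype F] [DecidableEq F] (G : F → K) :
    hammingNorm (fun u : Fˣ => G u) + Nat.card {x // G x = 0} + (if G 0 = 0 then 0 else 1) =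
      Fintype.card F := by
  have hunits : hammingNorm (fun u : Fˣ => G u) =
      ((Finset.univ.erase (0 : F)).filter fun x => G x ≠ 0).card := by
    rw [hammingNorm]
    refine Finset.card_bij (fun u _ => (u : F)) ?_ ?_ ?_
    · intro u hu
      simpa using hu
    · intro u _ v _ h
      exact Units.ext h
    · intro x hx
      simp only [Finset.mem_filter, Finset.mem_erase, Finset.mem_univ, and_true] at hx
      exact ⟨Units.mk0 x hx.1, by simpa using hx.2, rfl⟩
  have hsplit : (Finset.univ.filter fun x => G x ≠ 0).card =
      ((Finset.univ.erase (0 : F)).filter fun x => G x ≠ 0).card +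
        (if G 0 = 0 then 0 else 1) := by
    by_cases h : G 0 = 0
    · rw [if_pos h, add_zero]
      congr 1
      ext x
      simp only [Finset.mem_filter, Finset.mem_erase, Finset.mem_univ, true_and, and_true]
      exact ⟨fun hx => ⟨fun hx0 => hx (hx0 ▸ h), hx⟩, And.right⟩
    · rw [if_neg h, Finset.filter_erase, Finset.card_erase_add_one]
      simpa using h
  have htot := Finset.card_filter_add_card_filter_not (s := (Finset.univ : Finset F))
    (fun x => G x = 0)
  rw [Nat.card_eq_fintype_card, Fintype.card_subtype, hunits]
  rw [Finset.card_univ] at htot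
  simp only [ne_eq] at hsplit ⊢
  omega

theorem hammingNorm_codeword [DecidableEq K] [Fintype F] [DecidableEq F] {R : F[X]} {β : F} {b : K} :
    (hammingNorm (codeword K R β b) : ℚ) = Fintype.card F - (if b = 0 then 0 else 1) -
      Nat.card {x // traceForm K R x + Algebra.trace K F (β * x) + b = 0} := by
  have h := hammingNorm_units_add_card_zeros
    (fun x : F => traceForm K R x + Algebra.trace K F (β * x) + b)
  have h0 : traceForm K R 0 + Algebra.trace K F (β * 0) + b = b := by simp [traceForm]
  have hc : codeword K R β b =
      fun u : Fˣ => traceForm K R u + Algebra.trace K F (β * u) + b :=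
    funext fun u => codeword_apply_eq R β b u
  rw [hc]
  simp only [h0] at h
  rw [← h]
  push_cast
  ring

/-- With `c = α⁻¹`, substituting `c x` for `x` replaces `R` by `c • R(cX)` and `β` by `β c`, and
keeps `b`. -/
theorem isCyclicCode_of_comp_mem {L : Submodule F F[X]}
    (hL : ∀ (c : F), ∀ R ∈ L, c • R.comp (C c * X) ∈ L) :
    IsCyclicCode (codeOne K L) ∧ IsCyclicCode (codeTwo K L) := by
  have key : ∀ (α : Fˣ) (R : F[X]) (β : F) (b : K), (fun x : Fˣ => codeword K R β b (α⁻¹ * x)) =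
      codeword K (((α⁻¹ : Fˣ) : F) • R.comp (C ((α⁻¹ : Fˣ) : F) * X)) (β * ((α⁻¹ : Fˣ) : F)) b := by
    intro α R β b
    ext x
    simp only [codeword, Units.val_mul, eval_smul, eval_comp, eval_mul, eval_C, eval_X, smul_eq_mul]
    congr 2
    ring
  constructor
  · rintro α - _ ⟨R, hR, β, rfl⟩
    exact ⟨_, hL _ R hR, _, key α R β 0⟩
  · rintro α - _ ⟨R, hR, β, b, rfl⟩
    exact ⟨_, hL _ R hR, _, b, key α R β b⟩

theorem smul_comp_mem_linearizedSpan {K F : Type*} [Field K] [Field F] [Fintype K] {s : ℕ} {ℓ : Fin s → ℕ} (c : F) {R : F[X]}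
    (hR : R ∈ linearizedSpan K F ℓ) : c • R.comp (C c * X) ∈ linearizedSpan K F ℓ := by
  obtain ⟨a, rfl⟩ := mem_linearizedSpan_iff.1 hR
  refine Submodule.smul_mem _ _ (mem_linearizedSpan_iff.2
    ⟨fun i => a i * c ^ Fintype.card K ^ ℓ i, ?_⟩)
  simp only [Polynomial.sum_comp, smul_comp, pow_comp, X_comp, ← smul_eq_C_mul, _root_.smul_pow,
    smul_smul]

theorem coe_codeTwo (L : Submodule F F[X]) : (codeTwo K L : Set (Fˣ → K)) =
    Set.range fun p : L × F × K => codeword K (p.1 : F[X]) p.2.1 p.2.2 := by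
  ext c
  constructor
  · rintro ⟨R, hR, β, b, rfl⟩
    exact ⟨(⟨R, hR⟩, β, b), rfl⟩
  · rintro ⟨⟨R, β, b⟩, rfl⟩
    exact ⟨R, R.2, β, b, rfl⟩

theorem coe_codeOne (L : Submodule F F[X]) : (codeOne K L : Set (Fˣ → K)) =
    Set.range fun p : L × F => codeword K (p.1 : F[X]) p.2 (0 : K) := by
  ext c
  constructor
  · rintro ⟨R, hR, β, rfl⟩
    exact ⟨(⟨R, hR⟩, β), rfl⟩
  · rintro ⟨⟨R, β⟩, rfl⟩
    exact ⟨R, R.2, β, rfl⟩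

theorem weightFreq_eq_sum [DecidableEq K] {ι κ : Type*} [Fintype ι] [Fintype κ]
    {C : Submodule K (κ → K)} {θ : ι → κ → K} (hθ : Function.Injective θ)
    (hC : (C : Set (κ → K)) = Set.range θ) (w : ℕ) :
    (weightFreq C w : ℚ) = ∑ p, if (w : ℚ) = hammingNorm (θ p) then 1 else 0 := by
  have : {c | c ∈ C ∧ hammingNorm c = w} = θ '' {p | w = hammingNorm (θ p)} := by
    ext c
    constructor
    · rintro ⟨hc, hw⟩
      have hc' : c ∈ (C : Set (κ → K)) := hc
      rw [hC] at hc'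
      obtain ⟨p, rfl⟩ := hc'
      exact ⟨p, hw.symm, rfl⟩
    · rintro ⟨p, hp, rfl⟩
      refine ⟨?_, hp.symm⟩
      have : θ p ∈ (C : Set (κ → K)) := hC ▸ Set.mem_range_self p
      exact this
  rw [weightFreq, this, Set.ncard_image_of_injective _ hθ, Finset.sum_boole,
    ← Set.ncard_coe_finset]
  simp [Nat.cast_inj]

variable [Fintype K] [Fintype F] {s : ℕ} {ℓ : Fin s → ℕ}

/-- Second differences show that the polar form equals the constant `b` wherever `x`, `y` and `x +
y` are nonzero. Additivity in one argument then gives `b = 2b`, so `b = 0` and the polar form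
vanishes, whence `R = 0`; nondegeneracy of the trace gives `β = 0`. -/
theorem eq_zero_of_codeword_eq_zero (hs : 1 ≤ s) (hℓ : Function.Injective ℓ)
    (hℓ_pos : ∀ i, 1 ≤ ℓ i) (hℓ_lt : ∀ i, 2 * ℓ i < Module.finrank K F) {R : F[X]}
    (hR : R ∈ linearizedSpan K F ℓ) {β : F} {b : K} (h : codeword K R β b = 0) :
    R = 0 ∧ β = 0 ∧ b = 0 := by
  classical
  have : FiniteDimensional K F := Module.Finite.of_finite
  obtain ⟨g, hg⟩ := exists_linearMap_eq_eval hR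
  have hG : ∀ x : F, x ≠ 0 →
      Algebra.trace K F (x * g x) + Algebra.trace K F (β * x) + b = 0 := by
    intro x hx
    have := congrFun h (Units.mk0 x hx)
    rw [codeword_apply_eq] at this
    simpa [traceForm, hg] using this
  have hpol : ∀ x y : F, x ≠ 0 → y ≠ 0 → x + y ≠ 0 →
      Algebra.trace K F (x * g y) + Algebra.trace K F (y * g x) = b := by
    intro x y hx hy hxy
    have h1 := hG x hx
    have h2 := hG y hy
    have h3 := hG (x + y) hxy
    simp only [map_add, mul_add, add_mul] at h3
    linear_combination h3 - h1 - h2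
  -- From `1 ≤ ℓ` and `2ℓ < m` one has `m ≥ 3`; this leaves room to choose `y` and `z` away from the
  -- few excluded values.
  have hcard : 8 ≤ Fintype.card F := by
    rw [Module.card_eq_pow_finrank (K := K) (V := F)]
    have h1 := hℓ_pos ⟨0, hs⟩
    have h2 := hℓ_lt ⟨0, hs⟩
    calc 8 = 2 ^ 3 := by norm_num
      _ ≤ Fintype.card K ^ 3 := Nat.pow_le_pow_left Fintype.one_lt_card 3
      _ ≤ _ := Nat.pow_le_pow_right Fintype.card_pos (by omega)
  have havoid : ∀ S : Finset F, S.card < 8 → ∃ y, y ∉ S := by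
    intro S hS
    by_contra! hcon
    have : S = Finset.univ := Finset.eq_univ_iff_forall.2 hcon
    rw [this, Finset.card_univ] at hS
    omega
  have hb : b = 0 := by
    obtain ⟨y, hy⟩ := havoid {0, -1} ((Finset.card_le_two).trans_lt (by norm_num))
    obtain ⟨z, hz⟩ := havoid {0, -1, -y, -1 - y} ((Finset.card_le_four).trans_lt (by norm_num))
    simp only [Finset.mem_insert, Finset.mem_singleton, not_or] at hy hz
    obtain ⟨hy0, hy1⟩ := hy
    obtain ⟨hz0, hz1, hzy, hzy1⟩ := hz
    have h1 := hpol 1 y one_ne_zero hy0 fun h => hy1 (by linear_combination h)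
    have h2 := hpol 1 z one_ne_zero hz0 fun h => hz1 (by linear_combination h)
    have h3 := hpol 1 (y + z) one_ne_zero (fun h => hzy (by linear_combination h))
      fun h => hzy1 (by linear_combination h)
    simp only [map_add, mul_add, add_mul] at h3
    linear_combination h3 - h1 - h2
  subst hb
  have hG' : ∀ x : F, Algebra.trace K F (x * g x) + Algebra.trace K F (β * x) = 0 := by
    intro x
    by_cases hx : x = 0
    · simp [hx]
    · simpa using hG x hx
  have hR0 : R = 0 := by
    refine eq_zero_of_polar_traceForm_eq_zero hℓ hℓ_pos hℓ_lt hR fun x y => ?_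
    rw [← hg, ← hg]
    have h1 := hG' x
    have h2 := hG' y
    have h3 := hG' (x + y)
    simp only [map_add, mul_add, add_mul] at h3
    linear_combination h3 - h1 - h2
  refine ⟨hR0, eq_zero_of_trace_mul_eq_zero (K := K) fun x => ?_, rfl⟩
  have := hG' x
  rw [hg, hR0] at this
  simpa using this

theorem codeword_injective (hs : 1 ≤ s) (hℓ : Function.Injective ℓ)
    (hℓ_pos : ∀ i, 1 ≤ ℓ i) (hℓ_lt : ∀ i, 2 * ℓ i < Module.finrank K F) :
    Function.Injective fun p : linearizedSpan K F ℓ × F × K =>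
      codeword K (p.1 : F[X]) p.2.1 p.2.2 := by
  rintro ⟨R, β, b⟩ ⟨R', β', b'⟩ h
  obtain ⟨h1, h2, h3⟩ := eq_zero_of_codeword_eq_zero hs hℓ hℓ_pos hℓ_lt (R - R').2
    (β := β - β') (b := b - b') (by
      rw [Submodule.coe_sub, codeword_sub, sub_eq_zero]
      exact h)
  rw [ZeroMemClass.coe_eq_zero, sub_eq_zero] at h1
  rw [h1, sub_eq_zero.1 h2, sub_eq_zero.1 h3]

theorem codeword_zero_injective (hs : 1 ≤ s) (hℓ : Function.Injective ℓ)
    (hℓ_pos : ∀ i, 1 ≤ ℓ i) (hℓ_lt : ∀ i, 2 * ℓ i < Module.finrank K F) :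
    Function.Injective fun p : linearizedSpan K F ℓ × F =>
      codeword K (p.1 : F[X]) p.2 (0 : K) := by
  intro p p' h
  have := codeword_injective hs hℓ hℓ_pos hℓ_lt (a₁ := (p.1, p.2, 0)) (a₂ := (p'.1, p'.2, 0)) h
  simp only [Prod.mk.injEq, and_true] at this
  exact Prod.ext this.1 this.2

theorem finrank_eq_of_natCard_eq_pow {V : Type*} [AddCommGroup V] [Module K V]
    [FiniteDimensional K V] {n : ℕ} (h : Nat.card V = Nat.card K ^ n) : Module.finrank K V = n := by
  rw [Module.natCard_eq_pow_finrank (K := K)] at h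
  exact Nat.pow_right_injective Finite.one_lt_card h

theorem natCard_linearizedSpan (hℓ : Function.Injective ℓ) :
    Nat.card (linearizedSpan K F ℓ) = Nat.card K ^ (Module.finrank K F * s) := by
  rw [Module.natCard_eq_pow_finrank (K := F), finrank_linearizedSpan hℓ,
    Module.natCard_eq_pow_finrank (K := K) (V := F), pow_mul]

theorem finrank_codeOne (hs : 1 ≤ s) (hℓ : Function.Injective ℓ)
    (hℓ_pos : ∀ i, 1 ≤ ℓ i) (hℓ_lt : ∀ i, 2 * ℓ i < Module.finrank K F) :
    Module.finrank K (codeOne K (linearizedSpan K F ℓ)) = Module.finrank K F * (s + 1) := by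
  apply finrank_eq_of_natCard_eq_pow
  have h1 : Nat.card (codeOne K (linearizedSpan K F ℓ)) = Nat.card (linearizedSpan K F ℓ × F) := by
    rw [← Nat.card_range_of_injective (codeword_zero_injective hs hℓ hℓ_pos hℓ_lt), ← coe_codeOne]
    rfl
  rw [h1, Nat.card_prod, natCard_linearizedSpan hℓ, Module.natCard_eq_pow_finrank (K := K) (V := F),
    ← pow_add]
  rfl

theorem finrank_codeTwo (hs : 1 ≤ s) (hℓ : Function.Injective ℓ)
    (hℓ_pos : ∀ i, 1 ≤ ℓ i) (hℓ_lt : ∀ i, 2 * ℓ i < Module.finrank K F) :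
    Module.finrank K (codeTwo K (linearizedSpan K F ℓ)) = Module.finrank K F * (s + 1) + 1 := by
  apply finrank_eq_of_natCard_eq_pow
  have h1 : Nat.card (codeTwo K (linearizedSpan K F ℓ)) =
      Nat.card (linearizedSpan K F ℓ × F × K) := by
    rw [← Nat.card_range_of_injective (codeword_injective hs hℓ hℓ_pos hℓ_lt), ← coe_codeTwo]
    rfl
  rw [h1, Nat.card_prod, Nat.card_prod, natCard_linearizedSpan hℓ,
    Module.natCard_eq_pow_finrank (K := K) (V := F), mul_add, pow_add, pow_add, mul_one, pow_one,
    mul_assoc]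

end Codes

/-! ### Rows contributed by a single form -/

section Tables

theorem tableRow_eq_mul (W x : ℚ) (w : ℕ) :
    tableRow W x w = x * (if (w : ℚ) = W then 1 else 0) := by
  simp [tableRow]

/-- The contribution to the weight distribution of the words `Q_R + Tr(β ·)` for a fixed `R` of rank
`r` and type index `i`, the linear form `Tr(β ·)` vanishing on the radical. -/
def homogeneousRows (q m r i w : ℕ) : ℚ :=
  tableRow
      ((q : ℚ) ^ m - (q : ℚ) ^ ((m : ℤ) - 1)
        + (-1) ^ i * ((q : ℚ) - 1) * (q : ℚ) ^ ((m : ℤ) - (r : ℤ) / 2 - 1))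
      ((q : ℚ) ^ ((r : ℤ) - 1)
        + (-1) ^ (i + 1) * ((q : ℚ) - 1) * (q : ℚ) ^ ((r : ℤ) / 2 - 1)) w
    + tableRow
      ((q : ℚ) ^ m - (q : ℚ) ^ ((m : ℤ) - 1)
        + (-1) ^ (i + 1) * (q : ℚ) ^ ((m : ℤ) - (r : ℤ) / 2 - 1))
      (((q : ℚ) ^ ((r : ℤ) - 1) + (-1) ^ i * (q : ℚ) ^ ((r : ℤ) / 2 - 1)) * ((q : ℚ) - 1)) w

/-- The contribution to the weight distribution of the words `Q_R + Tr(β ·) + b` for a fixed `R` of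
rank `r` and type index `i` and a fixed `b ≠ 0`, the linear form `Tr(β ·)` vanishing on the
radical. -/
def inhomogeneousRows (q m r i w : ℕ) : ℚ :=
  tableRow
      ((q : ℚ) ^ m - (q : ℚ) ^ ((m : ℤ) - 1) - 1
        + (-1) ^ i * ((q : ℚ) - 1) * (q : ℚ) ^ ((m : ℤ) - (r : ℤ) / 2 - 1))
      ((q : ℚ) ^ ((r : ℤ) - 1) + (-1) ^ i * (q : ℚ) ^ ((r : ℤ) / 2 - 1)) w
    + tableRow
      ((q : ℚ) ^ m - (q : ℚ) ^ ((m : ℤ) - 1) - 1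
        + (-1) ^ (i + 1) * (q : ℚ) ^ ((m : ℤ) - (r : ℤ) / 2 - 1))
      ((q : ℚ) ^ r - (q : ℚ) ^ ((r : ℤ) - 1) + (-1) ^ (i + 1) * (q : ℚ) ^ ((r : ℤ) / 2 - 1)) w

/-- `R = 0` has rank `0` and type 1 but is excluded from `M_{0,1}`. At `r = 0` the general rows
collapse to the row of weight `0`, which the table lists separately. -/
theorem homogeneousRows_zero_one {q m : ℕ} (hq : q ≠ 0) (w : ℕ) :
    homogeneousRows q m 0 1 w = tableRow 0 1 w := by
  have hq' : (q : ℚ) ≠ 0 := by exact_mod_cast hq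
  have h1 : (q : ℚ) ^ m - (q : ℚ) ^ ((m : ℤ) - 1)
        + (-1) ^ 1 * ((q : ℚ) - 1) * (q : ℚ) ^ ((m : ℤ) - ((0 : ℕ) : ℤ) / 2 - 1) = 0 := by
    simp [zpow_sub_one₀ hq']
    field_simp
    ring
  have h2 : (q : ℚ) ^ (((0 : ℕ) : ℤ) - 1)
        + (-1) ^ (1 + 1) * ((q : ℚ) - 1) * (q : ℚ) ^ (((0 : ℕ) : ℤ) / 2 - 1) = 1 := by
    simp
    field_simp
    ring
  have h3 : ((q : ℚ) ^ (((0 : ℕ) : ℤ) - 1) + (-1) ^ 1 * (q : ℚ) ^ (((0 : ℕ) : ℤ) / 2 - 1)) *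
      ((q : ℚ) - 1) = 0 := by
    simp
  rw [homogeneousRows, h1, h2, h3]
  simp [tableRow]

/-- For `b ≠ 0` the first row has frequency `0`, and the second is the nonzero constant word, of
weight `q^m - 1`. -/
theorem inhomogeneousRows_zero_one {q m : ℕ} (hq : q ≠ 0) (w : ℕ) :
    inhomogeneousRows q m 0 1 w = tableRow ((q : ℚ) ^ m - 1) 1 w := by
  have hq' : (q : ℚ) ≠ 0 := by exact_mod_cast hq
  have h1 : (q : ℚ) ^ (((0 : ℕ) : ℤ) - 1) + (-1) ^ 1 * (q : ℚ) ^ (((0 : ℕ) : ℤ) / 2 - 1) = 0 := by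
    simp
  have h2 : (q : ℚ) ^ m - (q : ℚ) ^ ((m : ℤ) - 1) - 1
        + (-1) ^ (1 + 1) * (q : ℚ) ^ ((m : ℤ) - ((0 : ℕ) : ℤ) / 2 - 1) = (q : ℚ) ^ m - 1 := by
    simp
    ring
  have h3 : (q : ℚ) ^ 0 - (q : ℚ) ^ (((0 : ℕ) : ℤ) - 1)
      + (-1) ^ (1 + 1) * (q : ℚ) ^ (((0 : ℕ) : ℤ) / 2 - 1) = 1 := by
    simp
  rw [inhomogeneousRows, h1, h2, h3]
  simp [tableRow]

theorem cast_two_mul_ediv_two (h : ℕ) : ((2 * h : ℕ) : ℤ) / 2 = h := by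
  omega

variable {K F : Type*} [Field K] [Fintype K] [DecidableEq K] [Field F] [Fintype F] [DecidableEq F]
  [Algebra K F]

/-- The test function `T` is the indicator of the numbers of zeros that correspond to weight `w`. -/
theorem sum_weight_codeword_homogeneous {R : F[X]} {i : ℕ}
    (hRi : HasTypeIndex K (traceForm K R) i) (w : ℕ) :
    ∑ β : F, (if (w : ℚ) = hammingNorm (codeword K R β (0 : K)) then (1 : ℚ) else 0) =
      tableRow ((Fintype.card K : ℚ) ^ Module.finrank K F
          - (Fintype.card K : ℚ) ^ ((Module.finrank K F : ℤ) - 1))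
        ((Fintype.card K : ℚ) ^ Module.finrank K F
          - (Fintype.card K : ℚ) ^ qfRank K (traceForm K R)) w
      + homogeneousRows (Fintype.card K) (Module.finrank K F) (qfRank K (traceForm K R)) i w := by
  obtain ⟨h, hr, hle, hi, hsum⟩ := hRi.sum_card_zeros
  have hs := hsum 0 (Fintype.card K : ℚ) (by rw [Nat.card_eq_fintype_card])
    (fun n => if (w : ℚ) = (Fintype.card K : ℚ) ^ Module.finrank K F - 0 - n then 1 else 0)
  have hcard : (Fintype.card F : ℚ) = (Fintype.card K : ℚ) ^ Module.finrank K F := by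
    rw [Module.card_eq_pow_finrank (K := K) (V := F)]
    push_cast
    rfl
  have hq0 : (Fintype.card K : ℚ) ≠ 0 := by exact_mod_cast Fintype.card_ne_zero
  simp only [hammingNorm_codeword, if_true, hcard]
  rw [hs, homogeneousRows, hr, tableRow_eq_mul, tableRow_eq_mul, tableRow_eq_mul,
    cast_two_mul_ediv_two]
  rw [if_pos rfl, pow_succ]
  have hfreq : (Fintype.card K : ℚ) ^ (2 * h) =
      (Fintype.card K : ℚ) ^ ((2 * h : ℤ) - 1) * Fintype.card K := by
    rw [zpow_sub_one₀ hq0, inv_mul_cancel_right₀ hq0]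
    norm_cast
  push_cast
  rw [hfreq, ← add_assoc]
  congr 1
  · congr 1
    · rw [sub_zero]
    · congr 1
      · ring
      · congr 2
        ring
  · congr 1
    · ring
    · congr 2
      ring

theorem sum_weight_codeword_inhomogeneous {R : F[X]} {i : ℕ} {b : K}
    (hb : b ≠ 0) (hRi : HasTypeIndex K (traceForm K R) i) (w : ℕ) :
    ∑ β : F, (if (w : ℚ) = hammingNorm (codeword K R β b) then (1 : ℚ) else 0) =
      tableRow ((Fintype.card K : ℚ) ^ Module.finrank K F
          - (Fintype.card K : ℚ) ^ ((Module.finrank K F : ℤ) - 1) - 1)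
        ((Fintype.card K : ℚ) ^ Module.finrank K F
          - (Fintype.card K : ℚ) ^ qfRank K (traceForm K R)) w
      + inhomogeneousRows (Fintype.card K) (Module.finrank K F) (qfRank K (traceForm K R)) i w := by
  obtain ⟨h, hr, hle, hi, hsum⟩ := hRi.sum_card_zeros
  have hs := hsum b (Fintype.card K : ℚ) (by rw [Nat.card_eq_fintype_card])
    (fun n => if (w : ℚ) = (Fintype.card K : ℚ) ^ Module.finrank K F - 1 - n then 1 else 0)
  have hcard : (Fintype.card F : ℚ) = (Fintype.card K : ℚ) ^ Module.finrank K F := by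
    rw [Module.card_eq_pow_finrank (K := K) (V := F)]
    push_cast
    rfl
  have hq0 : (Fintype.card K : ℚ) ≠ 0 := by exact_mod_cast Fintype.card_ne_zero
  simp only [hammingNorm_codeword, if_neg hb, hcard]
  rw [hs, inhomogeneousRows, hr, tableRow_eq_mul, tableRow_eq_mul, tableRow_eq_mul,
    cast_two_mul_ediv_two]
  rw [if_neg hb, pow_succ]
  have hfreq : (Fintype.card K : ℚ) ^ (2 * h) =
      (Fintype.card K : ℚ) ^ ((2 * h : ℤ) - 1) * Fintype.card K := by
    rw [zpow_sub_one₀ hq0, inv_mul_cancel_right₀ hq0]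
    norm_cast
  push_cast
  rw [hfreq, ← add_assoc]
  congr 1
  · congr 1
    · rw [sub_right_comm]
    · congr 1
      · ring
      · congr 2
        ring
  · congr 1
    · ring
    · congr 2
      ring

end Tables

/-! ### Summation over the family -/

section WeightDistribution

/-- A quadratic form over a finite field is not both of type `1` and of type `3`. -/
theorem not_isTypeThree_of_isTypeOne {K F : Type*} [Field K] [Finite K] [Field F] [Algebra K F]
    [FiniteDimensional K F] {Q : F → K} (h1 : IsTypeOne K Q) (h3 : IsTypeThree K Q) : False := by
  classical
  obtain ⟨k, t, h, N, f, hkt, -, hf, hP, hQ, hZ⟩ :=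
    HasTypeIndex.exists_factor (i := 1) (show HasTypeIndex K Q 1 from h1)
  obtain ⟨k', t', h', N', f', hkt', -, hf', hP', hQ', hZ'⟩ :=
    HasTypeIndex.exists_factor (i := 2) (show HasTypeIndex K Q 2 from h3)
  have hr := qfRank_eq_finrank f hf _ (fun x _ => hP x) hQ
  have hr' := qfRank_eq_finrank f' hf' _ (fun x _ => hP' x) hQ'
  have hZ0 := hZ 0
  have hZ0' := hZ' 0
  have hc : Nat.card {x // Q x = 0} =
      Nat.card (LinearMap.ker f) * Nat.card {y // wittForm k N y = 0} := by
    simp_rw [hQ]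
    exact card_subtype_comp_of_surjective f hf fun y => wittForm k N y = 0
  have hc' : Nat.card {x // Q x = 0} =
      Nat.card (LinearMap.ker f') * Nat.card {y // wittForm k' N' y = 0} := by
    simp_rw [hQ']
    exact card_subtype_comp_of_surjective f' hf' fun y => wittForm k' N' y = 0
  rw [card_ker_of_surjective f hf, ← hr] at hc
  rw [card_ker_of_surjective f' hf', ← hr', hc] at hc'
  have heq := Nat.eq_of_mul_eq_mul_left (pow_pos Nat.card_pos _) hc'
  rw [finrank_wittSpace, hkt] at hr
  rw [finrank_wittSpace, hkt', hr] at hr'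
  obtain rfl : h = h' := by omega
  -- Both factorizations have the same `h` and equally large kernels, so their zero counts agree;
  -- yet these differ in the sign of a positive term.
  rw [heq, hZ0', if_pos rfl] at hZ0
  have hq : (1 : ℚ) < Nat.card K := by exact_mod_cast Finite.one_lt_card
  have hpos : 0 < ((Nat.card K : ℚ) - 1) * (Nat.card K : ℚ) ^ ((h : ℤ) - 1) :=
    mul_pos (by linarith) (zpow_pos (by linarith) _)
  norm_num at hZ0
  linarith

variable {K F : Type*} [Field K] [Field F] [Algebra K F]

theorem hasTypeIndex_one_traceForm_zero : HasTypeIndex K (traceForm K (0 : F[X])) 1 :=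
  ⟨0, Fin.elim0, Fin.elim0, linearIndependent_empty_type, fun x => by simp [traceForm]⟩

theorem qfRank_traceForm_zero : qfRank K (traceForm K (0 : F[X])) = 0 :=
  Nat.sInf_eq_zero.2 (Or.inl ⟨0, 0, fun x => by simp [traceForm]⟩)

variable [Fintype K] [Fintype F]

/-- A sum over an even rank family of a function of rank and type, in terms of the numbers of forms
of given rank and type. -/
theorem sum_by_type {s : ℕ} {ℓ : Fin s → ℕ} (hL : IsEvenRankFamily K (linearizedSpan K F ℓ))
    [Fintype (linearizedSpan K F ℓ)] (A : F[X] → ℚ) (B : ℕ → ℕ → ℚ)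
    (hA : ∀ R i, HasTypeIndex K (traceForm K R) i → A R = B (qfRank K (traceForm K R)) i) :
    ∑ R : linearizedSpan K F ℓ, A R = B 0 1 +
      ∑ᶠ r ∈ rankSet K (linearizedSpan K F ℓ), ∑ i ∈ ({1, 2} : Finset ℕ),
        (rankTypeCount K (linearizedSpan K F ℓ) r i : ℚ) * B r i := by
  classical
  have : FiniteDimensional K F := Module.Finite.of_finite
  let ρ : linearizedSpan K F ℓ → ℕ := fun R => qfRank K (traceForm K (R : F[X]))
  have hset : rankSet K (linearizedSpan K F ℓ) = ((Finset.univ.image ρ : Finset ℕ) : Set ℕ) := by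
    ext r
    simp [rankSet, ρ]
  have hcount : ∀ r i, (rankTypeCount K (linearizedSpan K F ℓ) r i : ℚ) =
      ∑ R : linearizedSpan K F ℓ with ρ R = r,
        if (R : F[X]) ≠ 0 ∧ HasTypeIndex K (traceForm K (R : F[X])) i then (1 : ℚ) else 0 := by
    intro r i
    rw [Finset.sum_boole, Finset.filter_filter, rankTypeCount, ← Set.ncard_coe_finset,
      ← Set.ncard_image_of_injective _ (Subtype.val_injective (p := (· ∈ linearizedSpan K F ℓ)))]
    congr 2
    ext R
    constructor
    · rintro ⟨h1, h2, h3, h4⟩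
      exact ⟨⟨R, h1⟩, Finset.mem_coe.2 (Finset.mem_filter.2 ⟨Finset.mem_univ _, h3, h2, h4⟩), rfl⟩
    · rintro ⟨R, hR, rfl⟩
      obtain ⟨-, h3, h2, h4⟩ := Finset.mem_filter.1 (Finset.mem_coe.1 hR)
      exact ⟨R.2, h2, h3, h4⟩
  rw [hset, finsum_mem_coe_finset]
  have hinner : ∀ r ∈ Finset.univ.image ρ, ∑ i ∈ ({1, 2} : Finset ℕ),
        (rankTypeCount K (linearizedSpan K F ℓ) r i : ℚ) * B r i =
      ∑ R : linearizedSpan K F ℓ with ρ R = r, ∑ i ∈ ({1, 2} : Finset ℕ),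
        if (R : F[X]) ≠ 0 ∧ HasTypeIndex K (traceForm K (R : F[X])) i then B (ρ R) i else 0 := by
    intro r _
    rw [Finset.sum_comm]
    refine Finset.sum_congr rfl fun i _ => ?_
    rw [hcount, Finset.sum_mul]
    refine Finset.sum_congr rfl fun R hR => ?_
    rw [(Finset.mem_filter.1 hR).2]
    simp
  rw [Finset.sum_congr rfl hinner, Finset.sum_fiberwise_of_maps_to
    (fun R _ => Finset.mem_image_of_mem ρ (Finset.mem_univ R))]
  -- A nonzero `R` has exactly one type, so exactly one summand survives; `R = 0` is not counted in
  -- `M_{r,i}` and is put back as `B 0 1`.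
  have hterm : ∀ R : linearizedSpan K F ℓ, A R = (if R = 0 then B 0 1 else 0) +
      ∑ i ∈ ({1, 2} : Finset ℕ),
        if (R : F[X]) ≠ 0 ∧ HasTypeIndex K (traceForm K (R : F[X])) i then B (ρ R) i else 0 := by
    intro R
    rw [Finset.sum_pair (by norm_num)]
    by_cases hR : R = 0
    · subst hR
      have := hA 0 1 hasTypeIndex_one_traceForm_zero
      rw [qfRank_traceForm_zero] at this
      simpa using this
    · have hR' : (R : F[X]) ≠ 0 := fun h => hR (Subtype.ext h)
      obtain ⟨Q, hQ⟩ := exists_quadraticForm_eq_traceForm R.2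
      have heven : Even (qfRank K Q) := hQ ▸ hL R R.2
      rcases isTypeOne_or_isTypeThree_of_even Q heven with h1 | h3
      · rw [hQ] at h1
        have h1' : HasTypeIndex K (traceForm K (R : F[X])) 1 := h1
        have h3' : ¬ HasTypeIndex K (traceForm K (R : F[X])) 2 :=
          fun h => not_isTypeThree_of_isTypeOne h1 h
        rw [if_neg hR, if_pos ⟨hR', h1'⟩, if_neg fun h => h3' h.2, hA _ _ h1']
        simp [ρ]
      · rw [hQ] at h3
        have h3' : HasTypeIndex K (traceForm K (R : F[X])) 2 := h3
        have h1' : ¬ HasTypeIndex K (traceForm K (R : F[X])) 1 :=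
          fun h => not_isTypeThree_of_isTypeOne h h3
        rw [if_neg hR, if_neg fun h => h1' h.2, if_pos ⟨hR', h3'⟩, hA _ _ h3']
        simp [ρ]
  rw [Finset.sum_congr rfl fun R _ => hterm R, Finset.sum_add_distrib]
  simp

theorem sum_by_rank {K F : Type*} [Field K] [Fintype K] [Field F] [Algebra K F] {s : ℕ}
    {ℓ : Fin s → ℕ} [Fintype (linearizedSpan K F ℓ)] (g : ℕ → ℚ) :
    ∑ᶠ r ∈ rankSet K (linearizedSpan K F ℓ), (rankCount K (linearizedSpan K F ℓ) r : ℚ) * g r =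
      ∑ R : linearizedSpan K F ℓ, g (qfRank K (traceForm K (R : F[X]))) := by
  classical
  let ρ : linearizedSpan K F ℓ → ℕ := fun R => qfRank K (traceForm K (R : F[X]))
  have hset : rankSet K (linearizedSpan K F ℓ) = ((Finset.univ.image ρ : Finset ℕ) : Set ℕ) := by
    ext r
    simp [rankSet, ρ]
  have hcount : ∀ r, rankCount K (linearizedSpan K F ℓ) r =
      (Finset.univ.filter fun R => ρ R = r).card := by
    intro r
    rw [rankCount, ← Set.ncard_coe_finset,
      ← Set.ncard_image_of_injective _ (Subtype.val_injective (p := (· ∈ linearizedSpan K F ℓ)))]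
    congr 1
    ext R
    simp [ρ, and_comm]
  rw [hset, finsum_mem_coe_finset, ← Finset.sum_fiberwise_of_maps_to
    (fun R _ => Finset.mem_image_of_mem ρ (Finset.mem_univ R))]
  refine Finset.sum_congr rfl fun r _ => ?_
  rw [hcount, ← nsmul_eq_mul, ← Finset.sum_const]
  exact Finset.sum_congr rfl fun R hR => by rw [← (Finset.mem_filter.1 hR).2]

variable [DecidableEq K] [DecidableEq F]

/-- The middle row depends on the rank alone and includes `R = 0`. It is subtracted before
`sum_by_type` is applied and recovered through `sum_by_rank`. -/
theorem sum_homogeneous {s : ℕ} {ℓ : Fin s → ℕ} [Fintype (linearizedSpan K F ℓ)]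
    (hL : IsEvenRankFamily K (linearizedSpan K F ℓ)) (w : ℕ) :
    ∑ R : linearizedSpan K F ℓ, ∑ β : F,
      (if (w : ℚ) = hammingNorm (codeword K (R : F[X]) β (0 : K)) then (1 : ℚ) else 0) =
    tableOne (Fintype.card K) (Module.finrank K F) (rankSet K (linearizedSpan K F ℓ))
      (rankCount K (linearizedSpan K F ℓ)) (rankTypeCount K (linearizedSpan K F ℓ)) w := by
  set q := Fintype.card K with hq
  set m := Module.finrank K F with hm
  have h := sum_by_type hL
    (fun R => ∑ β : F, (if (w : ℚ) = hammingNorm (codeword K R β (0 : K)) then (1 : ℚ) else 0) -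
      tableRow ((q : ℚ) ^ m - (q : ℚ) ^ ((m : ℤ) - 1))
        ((q : ℚ) ^ m - (q : ℚ) ^ qfRank K (traceForm K R)) w)
    (fun r i => homogeneousRows q m r i w)
    (fun R i hRi => by rw [sum_weight_codeword_homogeneous hRi, add_sub_cancel_left])
  rw [Finset.sum_sub_distrib, sub_eq_iff_eq_add, homogeneousRows_zero_one Fintype.card_ne_zero] at h
  rw [h, tableOne, sum_by_rank fun r => (q : ℚ) ^ m - (q : ℚ) ^ r, add_right_comm]
  refine congr_arg₂ _ (congr_arg₂ _ rfl ?_)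
    (finsum_mem_congr rfl fun r _ => Finset.sum_congr rfl fun i _ => ?_)
  · simp only [tableRow_eq_mul, Finset.sum_mul]
  · simp only [homogeneousRows, tableRow_eq_mul]
    ring

theorem sum_inhomogeneous {s : ℕ} {ℓ : Fin s → ℕ} [Fintype (linearizedSpan K F ℓ)]
    (hL : IsEvenRankFamily K (linearizedSpan K F ℓ)) {b : K} (hb : b ≠ 0) (w : ℕ) :
    ∑ R : linearizedSpan K F ℓ, ∑ β : F,
      (if (w : ℚ) = hammingNorm (codeword K (R : F[X]) β b) then (1 : ℚ) else 0) =
    tableRow ((Fintype.card K : ℚ) ^ Module.finrank K F - 1) 1 w +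
      ∑ᶠ r ∈ rankSet K (linearizedSpan K F ℓ), ∑ i ∈ ({1, 2} : Finset ℕ),
        (rankTypeCount K (linearizedSpan K F ℓ) r i : ℚ) *
          inhomogeneousRows (Fintype.card K) (Module.finrank K F) r i w +
      tableRow ((Fintype.card K : ℚ) ^ Module.finrank K F
          - (Fintype.card K : ℚ) ^ ((Module.finrank K F : ℤ) - 1) - 1)
        (∑ᶠ r ∈ rankSet K (linearizedSpan K F ℓ), (rankCount K (linearizedSpan K F ℓ) r : ℚ) *
          ((Fintype.card K : ℚ) ^ Module.finrank K F - (Fintype.card K : ℚ) ^ r)) w := by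
  set q := Fintype.card K with hq
  set m := Module.finrank K F with hm
  have h := sum_by_type hL
    (fun R => ∑ β : F, (if (w : ℚ) = hammingNorm (codeword K R β b) then (1 : ℚ) else 0) -
      tableRow ((q : ℚ) ^ m - (q : ℚ) ^ ((m : ℤ) - 1) - 1)
        ((q : ℚ) ^ m - (q : ℚ) ^ qfRank K (traceForm K R)) w)
    (fun r i => inhomogeneousRows q m r i w)
    (fun R i hRi => by rw [sum_weight_codeword_inhomogeneous hb hRi, add_sub_cancel_left])
  rw [Finset.sum_sub_distrib, sub_eq_iff_eq_add,
    inhomogeneousRows_zero_one Fintype.card_ne_zero] at h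
  rw [h, sum_by_rank fun r => (q : ℚ) ^ m - (q : ℚ) ^ r]
  refine congr_arg₂ _ rfl ?_
  simp only [tableRow_eq_mul, Finset.sum_mul]

end WeightDistribution

theorem theorem3p4 {K F : Type*} [Field K] [Fintype K] [DecidableEq K]
    [Field F] [Fintype F] [DecidableEq F] [Algebra K F]
    (q m s : ℕ) (hq : Fintype.card K = q) (hm : Module.finrank K F = m) (hs : 1 ≤ s)
    (ℓ : Fin s → ℕ) (hℓ : StrictMono ℓ) (hℓ_pos : ∀ i, 1 ≤ ℓ i) (hℓ_lt : ∀ i, 2 * ℓ i < m)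
    (hL : IsEvenRankFamily K (linearizedSpan K F ℓ)) :
    (IsCyclicCode (codeOne K (linearizedSpan K F ℓ)) ∧
      Module.finrank K (codeOne K (linearizedSpan K F ℓ)) = m * (s + 1) ∧
      ∀ w : ℕ, (weightFreq (codeOne K (linearizedSpan K F ℓ)) w : ℚ) =
        tableOne q m (rankSet K (linearizedSpan K F ℓ)) (rankCount K (linearizedSpan K F ℓ))
          (rankTypeCount K (linearizedSpan K F ℓ)) w) ∧
    (IsCyclicCode (codeTwo K (linearizedSpan K F ℓ)) ∧
      Module.finrank K (codeTwo K (linearizedSpan K F ℓ)) = m * (s + 1) + 1 ∧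
      ∀ w : ℕ, (weightFreq (codeTwo K (linearizedSpan K F ℓ)) w : ℚ) =
        tableTwo q m (rankSet K (linearizedSpan K F ℓ)) (rankCount K (linearizedSpan K F ℓ))
          (rankTypeCount K (linearizedSpan K F ℓ)) w) := by
  subst hq hm
  have hinj := hℓ.injective
  have hcyc := isCyclicCode_of_comp_mem (K := K) (L := linearizedSpan K F ℓ)
    fun c R hR => smul_comp_mem_linearizedSpan c hR
  have := Fintype.ofFinite (linearizedSpan K F ℓ)
  refine ⟨⟨hcyc.1, finrank_codeOne hs hinj hℓ_pos hℓ_lt, fun w => ?_⟩,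
    hcyc.2, finrank_codeTwo hs hinj hℓ_pos hℓ_lt, fun w => ?_⟩
  · rw [weightFreq_eq_sum (codeword_zero_injective hs hinj hℓ_pos hℓ_lt) (coe_codeOne _),
      Fintype.sum_prod_type, sum_homogeneous hL]
  · rw [weightFreq_eq_sum (codeword_injective hs hinj hℓ_pos hℓ_lt) (coe_codeTwo _),
      Fintype.sum_prod_type]
    simp_rw [Fintype.sum_prod_type_right]
    -- The words with `b = 0` give the first table; each of the `q - 1` other values of `b`
    -- contributes the same amount, whence the factor `q - 1` in all further rows.
    rw [Finset.sum_comm, ← Finset.add_sum_erase _ _ (Finset.mem_univ (0 : K)), sum_homogeneous hL,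
      Finset.sum_congr rfl fun b hb => sum_inhomogeneous hL (Finset.ne_of_mem_erase hb) w,
      Finset.sum_const, Finset.card_erase_of_mem (Finset.mem_univ _), Finset.card_univ,
      nsmul_eq_mul, Nat.cast_sub Fintype.card_pos, Nat.cast_one, tableTwo, add_assoc, add_assoc,
      add_assoc]
    congr 1
    rw [mul_add, mul_add, add_comm (_ * ∑ᶠ r ∈ rankSet K (linearizedSpan K F ℓ), _),
      mul_finsum_mem]
    refine congr_arg₂ _ ?_ (congr_arg₂ _ ?_ (finsum_mem_congr rfl fun r _ => ?_))
    · simp only [tableRow_eq_mul, one_mul]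
    · rw [tableRow_eq_mul, tableRow_eq_mul, mul_assoc]
    · rw [Finset.mul_sum]
      refine Finset.sum_congr rfl fun i _ => ?_
      simp only [inhomogeneousRows, tableRow_eq_mul]
      ring
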